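/- **Conventions.** Let $\mathfrak A$ be an alphabet and $\mathfrak A^*$ the free monoid on it. Let $\tau_1$ be the congruence on $\mathfrak A^*$ induced by the relations $a=a^2$ ($a\in\mathfrak A$), and let $\gamma$ be the congruence for which $\mathbf u\,\gamma\,\mathbf v$ if and only if $\mathbf u\,\tau_1\,\mathbf v$ and the same letters occur at least twice in $\mathbf u$ and in $\mathbf v$. For a letter $a$ write $\mathtt a$ for the $\gamma$-class $\{a\}$ and $\mathtt a^+$ for the $\gamma$-class $\{a^2,a^3,\dots\}$; juxtaposition denotes the product in $\mathfrak A^*/\gamma$. For $\mathtt W\subseteq\mathfrak A^*/\gamma$ let $\mathtt W^{\le}$ be the set of all $\mathtt v$ such that $\mathtt p\mathtt v\mathtt s\in\mathtt W$ for some $\mathtt p,\mathtt s\in\mathfrak A^*/\gamma$, let $M_\gamma(\mathtt W)$ be the Rees quotient of $\mathfrak A^*/\gamma$ over the ideal $(\mathfrak A^*/\gamma)\setminus\mathtt W^{\le}$, and let $\mathbb M_\gamma(\mathtt W)$ be the variety of monoids generated by $M_\gamma(\mathtt W)$; braces around the elements of $\mathtt W$ are omitted. Consider the semigroups with zero $$A_0=\langle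 e,f\mid e^2=e,\ f^2=f,\ ef=0\rangle,$$ $$A=\langle e,f,c\mid e^2=e,\ f^2=f,\ ef=ce=0,\ ec=cf=c\rangle,$$ $$Q=\langle e,b,c\mid e^2=e,\ eb=b,\ ce=c,\ ec=be=cb=0\rangle.$$ Write $S^1$ for the monoid obtained from a semigroup $S$ by adjoining an identity element, and let $\mathbb A_0,\mathbb A,\mathbb Q$ be the monoid varieties generated by $A_0^1,A^1,Q^1$ respectively. Let $\overline{\mathbb A}$ be the dual variety of $\mathbb A$, which consists of the monoids anti-isomorphic to monoids from $\mathbb A$. In the lattice of monoid varieties, $\wedge$ is intersection and $\vee$ is join. **Theorem.** Let $a,b,t,s$ be pairwise distinct letters of $\mathfrak A$. Then: (i) $\mathbb Q=\mathbb M_\gamma(\mathtt{a^+tsa^+})$; (ii) $\mathbb A\wedge\overline{\mathbb A}=\mathbb A_0\vee\mathbb Q=\mathbb M_\gamma(\mathtt{a^+b^+},\ \mathtt{a^+tsa^+})$; (iii) $\mathbb A=\mathbb M_\gamma(\mathtt{a^+b^+ta^+})$ and, dually, $\overline{\mathbb A}=\mathbb M_\gamma(\mathtt{a^+tb^+a^+})$;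 (iv) $\mathbb A\vee\overline{\mathbb A}=\mathbb M_\gamma(\mathtt{a^+b^+ta^+},\ \mathtt{a^+tb^+a^+})$. -/

import Mathlib

set_option linter.unusedSimpArgs false

/-! ### Varieties of monoids -/

/-- A variety of monoids: a class of monoids closed under submonoids, homomorphic images and
arbitrary direct products. -/
@[ext]
structure MonoidVariety where
  /-- membership of a monoid in the variety -/
  Mem : (M : Type) → [Monoid M] → Prop
  mem_submonoid : ∀ (M : Type) [Monoid M] (S : Submonoid M), Mem M → Mem S
  mem_of_surjective : ∀ (M N : Type) [Monoid M] [Monoid N] (f : M →* N),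
    Function.Surjective f → Mem M → Mem N
  mem_pi : ∀ (ι : Type) (M : ι → Type) [∀ i, Monoid (M i)],
    (∀ i, Mem (M i)) → Mem (∀ i, M i)

namespace MonoidVariety

/-- Varieties are ordered by inclusion. -/
instance : PartialOrder MonoidVariety where
  le V W := ∀ (M : Type) [Monoid M], V.Mem M → W.Mem M
  le_refl _ _ _ h := h
  le_trans _ _ _ h₁ h₂ M _ h := h₂ M (h₁ M h)
  le_antisymm V W h₁ h₂ := by
    ext M i
    exact ⟨h₁ M, h₂ M⟩

/-- The intersection of a set of varieties. -/
instance : InfSet MonoidVariety where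
  sInf 𝒱 :=
    { Mem := fun M _ => ∀ V ∈ 𝒱, V.Mem M
      mem_submonoid := fun M _ S h V hV => V.mem_submonoid M S (h V hV)
      mem_of_surjective := fun M N _ _ f hf h V hV => V.mem_of_surjective M N f hf (h V hV)
      mem_pi := fun ι M _ h V hV => V.mem_pi ι M (fun i => h i V hV) }

/-- The complete lattice of monoid varieties: `V ⊓ W` is the intersection of `V` and `W`, and
`V ⊔ W` is the smallest variety containing both `V` and `W`. -/
instance : CompleteLattice MonoidVariety :=
  completeLatticeOfInf MonoidVariety fun _ =>
    ⟨fun V hV _ _ h => h V hV, fun _ hU M _ hM _ hV => hU hV M hM⟩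

/-- The variety `var M` generated by the monoid `M`: the smallest variety containing `M`. -/
def generatedBy (M : Type) [Monoid M] : MonoidVariety :=
  sInf {V | V.Mem M}

/-- The dual variety: a monoid `N` belongs to it if and only if `N` is anti-isomorphic to a monoid
from `V`, that is, if and only if the opposite monoid of `N` belongs to `V`. -/
def dual (V : MonoidVariety) : MonoidVariety where
  Mem N _ := V.Mem Nᵐᵒᵖ
  mem_submonoid _ _ S h :=
    V.mem_of_surjective S.op (S : Type)ᵐᵒᵖ
      { toFun := fun x => MulOpposite.op ⟨x.1.unop, x.2⟩
        map_one' := rfl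
        map_mul' := fun _ _ => rfl }
      (fun y => ⟨⟨MulOpposite.op y.unop.1, y.unop.2⟩, rfl⟩) (V.mem_submonoid _ S.op h)
  mem_of_surjective _ _ _ _ f hf h :=
    V.mem_of_surjective _ _ (MonoidHom.op f)
      (fun y => (hf y.unop).elim fun x hx => ⟨MulOpposite.op x, congrArg MulOpposite.op hx⟩) h
  mem_pi ι M _ h :=
    V.mem_of_surjective (∀ i, (M i)ᵐᵒᵖ) (∀ i, M i)ᵐᵒᵖ
      { toFun := fun x => MulOpposite.op fun i => (x i).unop
        map_one' := rfl
        map_mul' := fun _ _ => rfl }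
      (fun y => ⟨fun i => MulOpposite.op (y.unop i), rfl⟩) (V.mem_pi ι _ h)

end MonoidVariety

/-! ### The monoids `M_τ(W)` -/

/-- The Rees congruence of a two-sided ideal `I` of a monoid: all elements of `I` are identified,
and nothing else is. -/
def reesCon {M : Type} [Monoid M] (I : Set M) (hI : ∀ x ∈ I, ∀ p s : M, p * x * s ∈ I) : Con M where
  r x y := x = y ∨ (x ∈ I ∧ y ∈ I)
  iseqv :=
    { refl := fun _ => Or.inl rfl
      symm := by
        rintro x y (h | ⟨h₁, h₂⟩)
        · exact Or.inl h.symm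
        · exact Or.inr ⟨h₂, h₁⟩
      trans := by
        rintro x y z (rfl | ⟨h₁, h₂⟩) (rfl | ⟨h₃, h₄⟩)
        · exact Or.inl rfl
        · exact Or.inr ⟨h₃, h₄⟩
        · exact Or.inr ⟨h₁, h₂⟩
        · exact Or.inr ⟨h₁, h₄⟩ }
  mul' := by
    have hl : ∀ x ∈ I, ∀ s : M, x * s ∈ I := fun x hx s => by simpa using hI x hx 1 s
    have hr : ∀ x ∈ I, ∀ p : M, p * x ∈ I := fun x hx p => by simpa using hI x hx p 1
    rintro w x y z (rfl | ⟨h₁, h₂⟩) (rfl | ⟨h₃, h₄⟩)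
    · exact Or.inl rfl
    · exact Or.inr ⟨hr _ h₃ _, hr _ h₄ _⟩
    · exact Or.inr ⟨hl _ h₁ _, hl _ h₂ _⟩
    · exact Or.inr ⟨hl _ h₁ _, hl _ h₂ _⟩

/-- The closure `W^{≤_τ}` of a set `W` of `τ`-words under the quasi-order `≤_τ`, where `v ≤_τ u`
means that `u = p ∘ v ∘ s` for some `τ`-words `p` and `s`. -/
def subwordClosure {𝔄 : Type} (τ : Con (FreeMonoid 𝔄)) (W : Set τ.Quotient) : Set τ.Quotient :=
  {v | ∃ u ∈ W, ∃ p s : τ.Quotient, u = p * v * s}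

/-- The complement of the closure of `W` is an ideal. -/
theorem compl_subwordClosure_ideal {𝔄 : Type} (τ : Con (FreeMonoid 𝔄)) (W : Set τ.Quotient) :
    ∀ x ∈ (subwordClosure τ W)ᶜ, ∀ p s : τ.Quotient, p * x * s ∈ (subwordClosure τ W)ᶜ := by
  rintro x hx p s ⟨u, hu, p', s', h⟩
  exact hx ⟨u, hu, p' * p, s * s', by simp only [h, mul_assoc]⟩

/-- `M_τ(W)`: the Rees quotient of `𝔄^* / τ` over the complement of the closure of `W`. -/
abbrev MTau {𝔄 : Type} (τ : Con (FreeMonoid 𝔄)) (W : Set τ.Quotient) : Type :=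
  (reesCon (subwordClosure τ W)ᶜ (compl_subwordClosure_ideal τ W)).Quotient

/-! ### The congruence `γ` -/

/-- The congruence `τ₁` on the free monoid `𝔄^*` induced by the relations `a = a²`, `a ∈ 𝔄`. -/
def tauOne (𝔄 : Type) : Con (FreeMonoid 𝔄) :=
  conGen fun u v => ∃ a : 𝔄, u = FreeMonoid.of a ∧ v = FreeMonoid.of a * FreeMonoid.of a

open Classical in
/-- `mul(u)`: the set of letters that occur at least twice in the word `u`. -/
def mulLetters {𝔄 : Type} (u : FreeMonoid 𝔄) : Set 𝔄 :=
  {a | 2 ≤ u.toList.count a}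

/-- `τ₁`-related words contain the same letters. -/
theorem tauOne_mem_iff {𝔄 : Type} {u v : FreeMonoid 𝔄} (h : tauOne 𝔄 u v) (x : 𝔄) :
    x ∈ u.toList ↔ x ∈ v.toList := by
  let c : Con (FreeMonoid 𝔄) :=
    { r := fun u v => x ∈ u.toList ↔ x ∈ v.toList
      iseqv := ⟨fun _ => Iff.rfl, Iff.symm, Iff.trans⟩
      mul' := fun h₁ h₂ => by
        simp only [FreeMonoid.toList_mul, List.mem_append]
        exact or_congr h₁ h₂ }
  have hc : tauOne 𝔄 ≤ c := by
    refine Con.conGen_le.2 ?_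
    rintro _ _ ⟨a, rfl, rfl⟩
    change x ∈ _ ↔ x ∈ _
    simp
  exact hc h

open Classical in
/-- The congruence `γ` on `𝔄^*`: two words are `γ`-related if and only if they are `τ₁`-related
and have the same sets of letters occurring at least twice. -/
def gammaCon (𝔄 : Type) : Con (FreeMonoid 𝔄) where
  r u v := tauOne 𝔄 u v ∧ mulLetters u = mulLetters v
  iseqv :=
    { refl := fun u => ⟨(tauOne 𝔄).refl u, rfl⟩
      symm := fun h => ⟨(tauOne 𝔄).symm h.1, h.2.symm⟩
      trans := fun h₁ h₂ => ⟨(tauOne 𝔄).trans h₁.1 h₂.1, h₁.2.trans h₂.2⟩ }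
  mul' := by
    rintro w x y z ⟨h₁, h₂⟩ ⟨h₃, h₄⟩
    refine ⟨(tauOne 𝔄).mul h₁ h₃, ?_⟩
    ext a
    have e₁ := tauOne_mem_iff h₁ a
    have e₂ := tauOne_mem_iff h₃ a
    have e₃ : 2 ≤ w.toList.count a ↔ 2 ≤ x.toList.count a := Set.ext_iff.1 h₂ a
    have e₄ : 2 ≤ y.toList.count a ↔ 2 ≤ z.toList.count a := Set.ext_iff.1 h₄ a
    rw [← List.count_pos_iff, ← List.count_pos_iff] at e₁ e₂
    change 2 ≤ (w * y).toList.count a ↔ 2 ≤ (x * z).toList.count a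
    simp only [FreeMonoid.toList_mul, List.count_append]
    omega

/-- The `γ`-class of the one-letter word `a`. -/
def gLetter {𝔄 : Type} (a : 𝔄) : (gammaCon 𝔄).Quotient :=
  (FreeMonoid.of a : FreeMonoid 𝔄)

/-- The `γ`-class `a⁺ = {a², a³, …}`, that is, the `γ`-class of `a²`. -/
def gPlus {𝔄 : Type} (a : 𝔄) : (gammaCon 𝔄).Quotient :=
  (FreeMonoid.of a * FreeMonoid.of a : FreeMonoid 𝔄)

/-- The monoid variety `𝕄_γ(W)` generated by the monoid `M_γ(W)`. -/
def varMGamma {𝔄 : Type} (W : Set (gammaCon 𝔄).Quotient) : MonoidVariety :=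
  MonoidVariety.generatedBy (MTau (gammaCon 𝔄) W)

/-! ### The semigroups `A₀`, `A` and `Q`

Each semigroup is defined by its multiplication table, which is then shown to be the one given by
the usual presentation. -/

/-- The semigroup with zero `A₀ = ⟨e, f ∣ e² = e, f² = f, ef = 0⟩ = {e, f, fe, 0}`. -/
inductive SgA0 : Type
  | e | f | fe | zero
  deriving DecidableEq

namespace SgA0

/-- The multiplication table (products not listed are zero). -/
protected def mul : SgA0 → SgA0 → SgA0
  | e, e => e
  | f, e => fe
  | f, f => f
  | f, fe => fe
  | fe, e => fe
  | _, _ => zero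

instance : SemigroupWithZero SgA0 where
  mul := SgA0.mul
  zero := zero
  mul_assoc := by rintro (_ | _) (_ | _) (_ | _) <;> rfl
  zero_mul := by rintro (_ | _) <;> rfl
  mul_zero := by rintro (_ | _) <;> rfl

/-- The map from the table to a semigroup with zero that is determined by the images of the
generators. -/
protected def liftFun {S : Type} [SemigroupWithZero S] (x y : S) : SgA0 → S
  | e => x
  | f => y
  | fe => y * x
  | zero => 0

/-- The table is given by the stated presentation: the defining relations hold, the elements are as
listed, and the universal property holds. -/
theorem presentation :
    (e * e = e ∧ f * f = f ∧ e * f = 0) ∧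
    (f * e = fe ∧ zero = 0) ∧
    ∀ (S : Type) [SemigroupWithZero S] (x y : S),
      x * x = x → y * y = y → x * y = 0 →
      ∃! φ : SgA0 →ₙ* S, φ 0 = 0 ∧ φ e = x ∧ φ f = y := by
  refine ⟨by decide, by decide, fun S _ x y h1 h2 h3 => ?_⟩
  have h1a : ∀ w, x * (x * w) = x * w := fun w => by
    rw [← mul_assoc, h1]
  have h2a : ∀ w, y * (y * w) = y * w := fun w => by
    rw [← mul_assoc, h2]
  have h3a : ∀ w, x * (y * w) = 0 := fun w => by
    rw [← mul_assoc, h3, zero_mul]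
  refine ⟨⟨SgA0.liftFun x y, ?_⟩, ⟨rfl, rfl, rfl⟩, ?_⟩
  · intro p q
    change SgA0.liftFun x y (SgA0.mul p q) = _
    cases p <;> cases q <;>
      simp [SgA0.mul, SgA0.liftFun, mul_assoc, h1, h2, h3, h1a, h2a, h3a]
  · rintro φ ⟨g0, ge, gf⟩
    ext p
    cases p
    · exact ge
    · exact gf
    · exact (map_mul φ f e).trans (by rw [gf, ge]; rfl)
    · exact g0

end SgA0

/-- The semigroup with zero `A = ⟨e, f, c ∣ e² = e, f² = f, ef = ce = 0, ec = cf = c⟩ = {e, f, c, fe, fc, 0}`. -/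
inductive SgA : Type
  | e | f | c | fe | fc | zero
  deriving DecidableEq

namespace SgA

/-- The multiplication table (products not listed are zero). -/
protected def mul : SgA → SgA → SgA
  | e, e => e
  | e, c => c
  | f, e => fe
  | f, f => f
  | f, c => fc
  | f, fe => fe
  | f, fc => fc
  | c, f => c
  | fe, e => fe
  | fe, c => fc
  | fc, f => fc
  | _, _ => zero

instance : SemigroupWithZero SgA where
  mul := SgA.mul
  zero := zero
  mul_assoc := by rintro (_ | _) (_ | _) (_ | _) <;> rfl
  zero_mul := by rintro (_ | _) <;> rfl
  mul_zero := by rintro (_ | _) <;> rfl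

/-- The map from the table to a semigroup with zero that is determined by the images of the
generators. -/
protected def liftFun {S : Type} [SemigroupWithZero S] (x y z : S) : SgA → S
  | e => x
  | f => y
  | c => z
  | fe => y * x
  | fc => y * z
  | zero => 0

/-- The table is given by the stated presentation: the defining relations hold, the elements are as
listed, and the universal property holds. -/
theorem presentation :
    (e * e = e ∧ f * f = f ∧ e * f = 0 ∧ c * e = 0 ∧ e * c = c ∧ c * f = c) ∧
    (f * e = fe ∧ f * c = fc ∧ zero = 0) ∧
    ∀ (S : Type) [SemigroupWithZero S] (x y z : S),
      x * x = x → y * y = y → x * y = 0 → z * x = 0 → x * z = z → z * y = z →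
      ∃! φ : SgA →ₙ* S, φ 0 = 0 ∧ φ e = x ∧ φ f = y ∧ φ c = z := by
  refine ⟨by decide, by decide, fun S _ x y z h1 h2 h3 h4 h5 h6 => ?_⟩
  have h1a : ∀ w, x * (x * w) = x * w := fun w => by
    rw [← mul_assoc, h1]
  have h2a : ∀ w, y * (y * w) = y * w := fun w => by
    rw [← mul_assoc, h2]
  have h3a : ∀ w, x * (y * w) = 0 := fun w => by
    rw [← mul_assoc, h3, zero_mul]
  have h4a : ∀ w, z * (x * w) = 0 := fun w => by
    rw [← mul_assoc, h4, zero_mul]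
  have h5a : ∀ w, x * (z * w) = z * w := fun w => by
    rw [← mul_assoc, h5]
  have h6a : ∀ w, z * (y * w) = z * w := fun w => by
    rw [← mul_assoc, h6]
  have k : z * z = 0 := by
    calc z * z = z * (x * z) := by rw [h5]
      _ = 0 := by rw [← mul_assoc, h4, zero_mul]
  have ka : ∀ w, z * (z * w) = 0 := fun w => by
    rw [← mul_assoc, k, zero_mul]
  refine ⟨⟨SgA.liftFun x y z, ?_⟩, ⟨rfl, rfl, rfl, rfl⟩, ?_⟩
  · intro p q
    change SgA.liftFun x y z (SgA.mul p q) = _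
    cases p <;> cases q <;>
      simp [SgA.mul, SgA.liftFun, mul_assoc, h1, h2, h3, h4, h5, h6, h1a, h2a, h3a, h4a, h5a, h6a, k, ka]
  · rintro φ ⟨g0, ge, gf, gc⟩
    ext p
    cases p
    · exact ge
    · exact gf
    · exact gc
    · exact (map_mul φ f e).trans (by rw [gf, ge]; rfl)
    · exact (map_mul φ f c).trans (by rw [gf, gc]; rfl)
    · exact g0

end SgA

/-- The semigroup with zero `Q = ⟨e, b, c ∣ e² = e, eb = b, ce = c, ec = be = cb = 0⟩ = {e, b, c, bc, 0}`. -/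
inductive SgQ : Type
  | e | b | c | bc | zero
  deriving DecidableEq

namespace SgQ

/-- The multiplication table (products not listed are zero). -/
protected def mul : SgQ → SgQ → SgQ
  | e, e => e
  | e, b => b
  | e, bc => bc
  | b, c => bc
  | c, e => c
  | bc, e => bc
  | _, _ => zero

instance : SemigroupWithZero SgQ where
  mul := SgQ.mul
  zero := zero
  mul_assoc := by rintro (_ | _) (_ | _) (_ | _) <;> rfl
  zero_mul := by rintro (_ | _) <;> rfl
  mul_zero := by rintro (_ | _) <;> rfl

/-- The map from the table to a semigroup with zero that is determined by the images of the
generators. -/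
protected def liftFun {S : Type} [SemigroupWithZero S] (x y z : S) : SgQ → S
  | e => x
  | b => y
  | c => z
  | bc => y * z
  | zero => 0

/-- The table is given by the stated presentation: the defining relations hold, the elements are as
listed, and the universal property holds. -/
theorem presentation :
    (e * e = e ∧ e * b = b ∧ c * e = c ∧ e * c = 0 ∧ b * e = 0 ∧ c * b = 0) ∧
    (b * c = bc ∧ zero = 0) ∧
    ∀ (S : Type) [SemigroupWithZero S] (x y z : S),
      x * x = x → x * y = y → z * x = z → x * z = 0 → y * x = 0 → z * y = 0 →
      ∃! φ : SgQ →ₙ* S, φ 0 = 0 ∧ φ e = x ∧ φ b = y ∧ φ c = z := by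
  refine ⟨by decide, by decide, fun S _ x y z h1 h2 h3 h4 h5 h6 => ?_⟩
  have h1a : ∀ w, x * (x * w) = x * w := fun w => by
    rw [← mul_assoc, h1]
  have h2a : ∀ w, x * (y * w) = y * w := fun w => by
    rw [← mul_assoc, h2]
  have h3a : ∀ w, z * (x * w) = z * w := fun w => by
    rw [← mul_assoc, h3]
  have h4a : ∀ w, x * (z * w) = 0 := fun w => by
    rw [← mul_assoc, h4, zero_mul]
  have h5a : ∀ w, y * (x * w) = 0 := fun w => by
    rw [← mul_assoc, h5, zero_mul]
  have h6a : ∀ w, z * (y * w) = 0 := fun w => by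
    rw [← mul_assoc, h6, zero_mul]
  have k1 : y * y = 0 := by
    calc y * y = y * (x * y) := by rw [h2]
      _ = 0 := by rw [← mul_assoc, h5, zero_mul]
  have k1a : ∀ w, y * (y * w) = 0 := fun w => by
    rw [← mul_assoc, k1, zero_mul]
  have k2 : z * z = 0 := by
    calc z * z = (z * x) * z := by rw [h3]
      _ = 0 := by rw [mul_assoc, h4, mul_zero]
  have k2a : ∀ w, z * (z * w) = 0 := fun w => by
    rw [← mul_assoc, k2, zero_mul]
  refine ⟨⟨SgQ.liftFun x y z, ?_⟩, ⟨rfl, rfl, rfl, rfl⟩, ?_⟩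
  · intro p q
    change SgQ.liftFun x y z (SgQ.mul p q) = _
    cases p <;> cases q <;>
      simp [SgQ.mul, SgQ.liftFun, mul_assoc, h1, h2, h3, h4, h5, h6, h1a, h2a, h3a, h4a, h5a, h6a, k1, k1a, k2, k2a]
  · rintro φ ⟨g0, ge, gb, gc⟩
    ext p
    cases p
    · exact ge
    · exact gb
    · exact gc
    · exact (map_mul φ b c).trans (by rw [gb, gc]; rfl)
    · exact g0

end SgQ

/-! ### The varieties

`WithOne S` is the monoid `S¹` obtained by adjoining an identity element to the semigroup `S`. -/

/-- `𝔸₀`, the variety generated by `A₀¹`. -/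
def varA0 : MonoidVariety := MonoidVariety.generatedBy (WithOne SgA0)

/-- `𝔸`, the variety generated by `A¹`. -/
def varA : MonoidVariety := MonoidVariety.generatedBy (WithOne SgA)

/-- `ℚ`, the variety generated by `Q¹`. -/
def varQ : MonoidVariety := MonoidVariety.generatedBy (WithOne SgQ)

set_option linter.unusedSimpArgs false

/-! ### Generation of varieties and Birkhoff's theorem -/

namespace MonoidVariety

/-! By Birkhoff's theorem (`mem_of_satisfies`), inclusions of varieties reduce to identities.

Each of `A₀¹`, `Q¹`, `A¹` and the opposite of `A¹` generates the same variety as `M_γ(w)` for one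
word `w`; a `WordModel` isolates the finite data this needs. On the one hand `T` embeds into
`M_γ(w)`, by choosing for each element a word with that value (`generatedBy_le`). On the other hand,
if `T` satisfies `u ≈ v` and `u` has nonzero value under the main evaluation, then `u` and `v`
reduce to normal forms that finitely many evaluations force to coincide, while a square-zero element
detects the repeated letters; so `u γ v` (`varMGamma_le`). Since `M_γ(W ∪ W')` embeds into `M_γ(W) ×
M_γ(W')`, joins correspond to unions of sets of words.

The substantial point is that every `N` in `𝔸 ∧ 𝔸̄` lies in `𝔸₀ ∨ ℚ`. Let `u ≈ v` hold in `A₀¹` and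
`Q¹`, and cut `u` at its simple letters, those occurring once. Identities of `Q¹` preserve the
contents of the blocks between simple letters; identities of `A₀¹` preserve, for distinct letters,
whether some `y` precedes some `x`. Identities of `𝔸` allow a letter of a block that already
occurred to the left of the block to be copied to the front of the block, and dually for letters
occurring to the right. After this padding, the order of two letters in the block matters only if
`y` does not occur before the block and `x` does not occur after it, and that order is the one `A₀¹`
controls. Blocks are thus replaced one by one from left to right (`satisfies_replace_block`,
`satisfies_append_of_satisfies`). -/

theorem mem_generatedBy (M : Type) [Monoid M] : (generatedBy M).Mem M := fun _ hV => hV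

theorem generatedBy_le_iff {M : Type} [Monoid M] {V : MonoidVariety} :
    generatedBy M ≤ V ↔ V.Mem M :=
  ⟨fun h => h M (mem_generatedBy M), fun h _ _ hN => hN V h⟩

theorem mem_of_injective (V : MonoidVariety) {M N : Type} [Monoid M] [Monoid N] (f : M →* N)
    (hf : Function.Injective f) (h : V.Mem N) : V.Mem M := by
  let e : M ≃* MonoidHom.mrange f := MulEquiv.ofBijective f.mrangeRestrict
    ⟨fun x y hxy => hf (congrArg Subtype.val hxy), f.mrangeRestrict_surjective⟩
  exact V.mem_of_surjective _ M e.symm.toMonoidHom e.symm.surjective (V.mem_submonoid N _ h)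

theorem mem_prod (V : MonoidVariety) {M N : Type} [Monoid M] [Monoid N] (hM : V.Mem M)
    (hN : V.Mem N) : V.Mem (M × N) := by
  let F : Bool → Type := fun b => match b with
    | true => M
    | false => N
  let inst : ∀ b, Monoid (F b) := Bool.rec ‹Monoid N› ‹Monoid M›
  have h : V.Mem (∀ b, F b) := @mem_pi V Bool F inst <| by
    rintro (_ | _)
    exacts [hN, hM]
  exact V.mem_of_surjective (∀ b, F b) (M × N)
    { toFun := fun g => (g true, g false)
      map_one' := rfl
      map_mul' := fun _ _ => rfl }
    (fun y => ⟨fun b => match b with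
      | true => y.1
      | false => y.2, rfl⟩) h

end MonoidVariety

/-- The monoid `M` satisfies the identity `u ≈ v`. -/
def Satisfies (M : Type) [Monoid M] {X : Type} (u v : List X) : Prop :=
  ∀ φ : X → M, (u.map φ).prod = (v.map φ).prod

namespace Satisfies

variable {M N X : Type} [Monoid M] [Monoid N] {u v w : List X}

theorem symm (h : Satisfies M u v) : Satisfies M v u := fun φ => (h φ).symm

theorem trans (h : Satisfies M u v) (h' : Satisfies M v w) : Satisfies M u w :=
  fun φ => (h φ).trans (h' φ)

theorem of_injective (f : M →* N) (hf : Function.Injective f) (h : Satisfies N u v) :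
    Satisfies M u v := fun φ => hf <| by
  simpa [map_list_prod, Function.comp_def] using h fun x => f (φ x)

theorem of_surjective (f : M →* N) (hf : Function.Surjective f) (h : Satisfies M u v) :
    Satisfies N u v := fun φ => by
  have := congrArg f (h fun x => (hf (φ x)).choose)
  simpa [map_list_prod, Function.comp_def, fun x => (hf (φ x)).choose_spec] using this

theorem pi {ι : Type} {M : ι → Type} [∀ i, Monoid (M i)] (h : ∀ i, Satisfies (M i) u v) :
    Satisfies (∀ i, M i) u v := fun φ => by
  funext i
  have := h i fun x => φ x i
  simpa [Pi.list_prod_apply, Function.comp_def] using this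

theorem prod (hM : Satisfies M u v) (hN : Satisfies N u v) : Satisfies (M × N) u v := fun φ => by
  have h₁ : ∀ w : List X, (w.map φ).prod.1 = (w.map fun x => (φ x).1).prod := fun w => by
    simpa [Function.comp_def] using map_list_prod (MonoidHom.fst M N) (w.map φ)
  have h₂ : ∀ w : List X, (w.map φ).prod.2 = (w.map fun x => (φ x).2).prod := fun w => by
    simpa [Function.comp_def] using map_list_prod (MonoidHom.snd M N) (w.map φ)
  ext
  · rw [h₁, h₁, hM]
  · rw [h₂, h₂, hN]

theorem reverse_of_op (h : Satisfies Mᵐᵒᵖ u v) : Satisfies M u.reverse v.reverse := fun φ => by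
  have := congrArg MulOpposite.unop (h fun x => MulOpposite.op (φ x))
  simpa [MulOpposite.unop_list_prod, Function.comp_def, List.map_reverse] using this

end Satisfies

namespace MonoidVariety

/-- The variety of all monoids satisfying the identity `u ≈ v`. -/
def ofIdentity {X : Type} (u v : List X) : MonoidVariety where
  Mem M _ := Satisfies M u v
  mem_submonoid _ _ S h := h.of_injective S.subtype Subtype.val_injective
  mem_of_surjective _ _ _ _ f hf h := h.of_surjective f hf
  mem_pi _ _ _ h := Satisfies.pi h

theorem satisfies_of_mem {M N X : Type} [Monoid M] [Monoid N] (hN : (generatedBy M).Mem N)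
    {u v : List X} (h : Satisfies M u v) : Satisfies N u v :=
  hN (ofIdentity u v) h

/-- **Birkhoff's theorem**: a monoid satisfying all identities of `M` lies in every variety
containing `M`. -/
theorem mem_of_satisfies (V : MonoidVariety) {M N : Type} [Monoid M] [Monoid N] (hM : V.Mem M)
    (h : ∀ u v : List N, Satisfies M u v → u.prod = v.prod) : V.Mem N := by
  -- `F` evaluates a word under all assignments at once, so its image is the relatively free monoid
  -- of `M` on the set `N`: a submonoid of a power of `M` that maps onto `N`.
  let F : FreeMonoid N →* ((N → M) → M) :=
    { toFun := fun w φ => FreeMonoid.lift φ w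
      map_one' := by ext; simp
      map_mul' := by intros; ext; simp }
  have hF : V.Mem (Con.ker F).Quotient :=
    V.mem_of_injective (Con.quotientKerEquivRange F).toMonoidHom
      (Con.quotientKerEquivRange F).injective
      (V.mem_submonoid _ _ (V.mem_pi (N → M) (fun _ => M) fun _ => hM))
  let g : (Con.ker F).Quotient →* N := Con.lift (Con.ker F) (FreeMonoid.lift id) <| by
    intro u v huv
    have huv' : F u = F v := huv
    have := h u.toList v.toList fun φ => by
      simpa [F, FreeMonoid.lift_apply] using congrFun huv' φ
    simpa [Con.ker_rel, FreeMonoid.lift_apply] using this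
  refine V.mem_of_surjective _ N g (fun n => ⟨((FreeMonoid.of n : FreeMonoid N) :
    (Con.ker F).Quotient), ?_⟩) hF
  simp [g]

theorem dual_generatedBy (M : Type) [Monoid M] : (generatedBy M).dual = generatedBy Mᵐᵒᵖ := by
  apply le_antisymm
  · intro N _ hN V hV
    have h : V.dual.Mem Nᵐᵒᵖ := hN V.dual hV
    exact V.mem_of_injective (MulEquiv.opOp N).toMonoidHom (MulEquiv.opOp N).injective h
  · rw [generatedBy_le_iff]
    exact (generatedBy M).mem_of_surjective M Mᵐᵒᵖᵐᵒᵖ (MulEquiv.opOp M).toMonoidHom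
      (MulEquiv.opOp M).surjective (mem_generatedBy M)

end MonoidVariety

/-! ### The variety of a union -/

theorem subwordClosure_mono {𝔄 : Type} (τ : Con (FreeMonoid 𝔄)) {W W' : Set τ.Quotient}
    (h : W ⊆ W') : subwordClosure τ W ⊆ subwordClosure τ W' :=
  fun _ ⟨u, hu, p, s, e⟩ => ⟨u, h hu, p, s, e⟩

theorem subwordClosure_union {𝔄 : Type} (τ : Con (FreeMonoid 𝔄)) (W W' : Set τ.Quotient) :
    subwordClosure τ (W ∪ W') = subwordClosure τ W ∪ subwordClosure τ W' := by
  ext v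
  constructor
  · rintro ⟨u, hu | hu, p, s, e⟩
    exacts [Or.inl ⟨u, hu, p, s, e⟩, Or.inr ⟨u, hu, p, s, e⟩]
  · rintro (h | h)
    exacts [subwordClosure_mono τ Set.subset_union_left h,
      subwordClosure_mono τ Set.subset_union_right h]

theorem reesCon_le {M : Type} [Monoid M] {I J : Set M} (hI) (hJ) (h : I ⊆ J) :
    reesCon I hI ≤ reesCon J hJ := by
  rintro x y (rfl | ⟨hx, hy⟩)
  exacts [Or.inl rfl, Or.inr ⟨h hx, h hy⟩]

/-- The canonical projection of `M_τ(W')` onto `M_τ(W)` for `W ⊆ W'`. -/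
def MTau.proj {𝔄 : Type} (τ : Con (FreeMonoid 𝔄)) {W W' : Set τ.Quotient} (h : W ⊆ W') :
    MTau τ W' →* MTau τ W :=
  Con.map _ _ (reesCon_le _ _ (Set.compl_subset_compl.2 (subwordClosure_mono τ h)))

theorem MTau.proj_surjective {𝔄 : Type} (τ : Con (FreeMonoid 𝔄)) {W W' : Set τ.Quotient}
    (h : W ⊆ W') : Function.Surjective (MTau.proj τ h) := by
  intro x
  induction x using Con.induction_on with
  | H x => exact ⟨(x : MTau τ W'), rfl⟩

theorem varMGamma_mono {𝔄 : Type} {W W' : Set (gammaCon 𝔄).Quotient} (h : W ⊆ W') :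
    varMGamma W ≤ varMGamma W' :=
  MonoidVariety.generatedBy_le_iff.2 <| MonoidVariety.mem_of_surjective _ _ _
    (MTau.proj _ h) (MTau.proj_surjective _ h) (MonoidVariety.mem_generatedBy _)

/-- The two projections jointly separate points: distinct elements identified by both lie outside
both closures, hence outside the closure of the union, and were already equal. -/
theorem varMGamma_union {𝔄 : Type} (W W' : Set (gammaCon 𝔄).Quotient) :
    varMGamma (W ∪ W') = varMGamma W ⊔ varMGamma W' := by
  apply le_antisymm
  · have hW : (varMGamma W ⊔ varMGamma W').Mem (MTau (gammaCon 𝔄) W) :=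
      le_sup_left (a := varMGamma W) _ (MonoidVariety.mem_generatedBy _)
    have hW' : (varMGamma W ⊔ varMGamma W').Mem (MTau (gammaCon 𝔄) W') :=
      le_sup_right (a := varMGamma W) _ (MonoidVariety.mem_generatedBy _)
    refine MonoidVariety.generatedBy_le_iff.2 (MonoidVariety.mem_of_injective _
      ((MTau.proj (gammaCon 𝔄) Set.subset_union_left).prod
        (MTau.proj (gammaCon 𝔄) Set.subset_union_right)) ?_
      (MonoidVariety.mem_prod _ hW hW'))
    intro x y hxy
    induction x, y using Con.induction_on₂ with
    | H x y =>
      have h₁ := (Con.eq _).1 (congrArg Prod.fst hxy)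
      have h₂ := (Con.eq _).1 (congrArg Prod.snd hxy)
      rw [Con.eq]
      rcases h₁ with h₁ | ⟨h₁, h₁'⟩
      · exact Or.inl h₁
      rcases h₂ with h₂ | ⟨h₂, h₂'⟩
      · exact Or.inl h₂
      refine Or.inr ?_
      rw [subwordClosure_union, Set.compl_union]
      exact ⟨⟨h₁, h₂⟩, h₁', h₂'⟩
  · exact sup_le (varMGamma_mono Set.subset_union_left) (varMGamma_mono Set.subset_union_right)

/-! ### The congruences `τ₁` and `γ` on concrete words -/

theorem eq_cons_of_head? {X : Type} {x : X} {l : List X} (h : l.head? = some x) : ∃ l', l = x :: l' := by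
  cases l with
  | nil => simp at h
  | cons y l => exact ⟨l, by simpa using h⟩

theorem tauOne_of_sq {X : Type} (x : X) :
    tauOne X (FreeMonoid.of x) (FreeMonoid.of x * FreeMonoid.of x) :=
  ConGen.Rel.of _ _ ⟨x, rfl, rfl⟩

/-! ### Collapsed words as normal forms for `τ₁`. -/

section Collapse

variable {X : Type} [DecidableEq X]

/-- Prepend a letter to a word unless the word already starts with it. -/
def pushLetter (x : X) (l : List X) : List X := if l.head? = some x then l else x :: l

/-- Replace every maximal block of equal adjacent letters by a single letter. -/
def collapse : List X → List X
  | [] => []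
  | x :: l => pushLetter x (collapse l)

theorem pushLetter_pushLetter (x : X) (l : List X) :
    pushLetter x (pushLetter x l) = pushLetter x l := by
  by_cases h : l.head? = some x <;> simp [pushLetter, h]

theorem mem_of_mem_collapse {x : X} {l : List X} (h : x ∈ collapse l) : x ∈ l := by
  induction l with
  | nil => exact h
  | cons y l ih =>
    rw [collapse, pushLetter] at h
    split_ifs at h
    · exact List.mem_cons_of_mem _ (ih h)
    · rcases List.mem_cons.1 h with rfl | h
      · exact List.mem_cons_self
      · exact List.mem_cons_of_mem _ (ih h)

theorem tauOne_collapse (l : List X) :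
    tauOne X (FreeMonoid.ofList l) (FreeMonoid.ofList (collapse l)) := by
  induction l with
  | nil => exact (tauOne X).refl _
  | cons x l ih =>
    have h₁ : tauOne X (FreeMonoid.ofList (x :: l)) (FreeMonoid.ofList (x :: collapse l)) :=
      (tauOne X).mul ((tauOne X).refl (FreeMonoid.of x)) ih
    rw [collapse, pushLetter]
    split_ifs with h
    · obtain ⟨l', hl'⟩ := eq_cons_of_head? h
      rw [hl'] at h₁ ⊢
      exact (tauOne X).trans h₁
        ((tauOne X).mul ((tauOne X).symm (tauOne_of_sq x)) ((tauOne X).refl (FreeMonoid.ofList l')))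
    · exact h₁

/-- Since `pushLetter x` is idempotent, the action of the free monoid on words by `pushLetter`
factors through `τ₁`, and acting on the empty word yields the collapsed word. -/
theorem collapse_eq_of_tauOne {u v : FreeMonoid X} (h : tauOne X u v) :
    collapse u.toList = collapse v.toList := by
  let P : FreeMonoid X →* Function.End (List X) := FreeMonoid.lift pushLetter
  have hP : ∀ w : List X, P (FreeMonoid.ofList w) [] = collapse w := by
    intro w
    induction w with
    | nil => rfl
    | cons x w ih =>
      rw [FreeMonoid.ofList_cons, map_mul]
      change P (FreeMonoid.of x) (P (FreeMonoid.ofList w) []) = _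
      rw [ih]
      rfl
  have hle : tauOne X ≤ Con.ker P := by
    refine Con.conGen_le.2 ?_
    rintro _ _ ⟨a, rfl, rfl⟩
    change P _ = P _
    rw [map_mul]
    funext l
    exact (pushLetter_pushLetter a l).symm
  have := congrFun (show P u = P v from hle h) []
  exact (hP u.toList).symm.trans (this.trans (hP v.toList))

theorem tauOne_iff {u v : FreeMonoid X} :
    tauOne X u v ↔ collapse u.toList = collapse v.toList :=
  ⟨collapse_eq_of_tauOne, fun h => (tauOne X).trans (tauOne_collapse u.toList)
    (h ▸ (tauOne X).symm (tauOne_collapse v.toList))⟩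

theorem mem_mulLetters {u : FreeMonoid X} {x : X} : x ∈ mulLetters u ↔ 2 ≤ u.toList.count x := by
  unfold mulLetters
  rw [Set.mem_ofPred_eq]
  convert Iff.rfl

theorem gammaCon_iff {u v : FreeMonoid X} :
    gammaCon X u v ↔ collapse u.toList = collapse v.toList ∧
      ∀ x, 2 ≤ u.toList.count x ↔ 2 ≤ v.toList.count x := by
  change tauOne X u v ∧ mulLetters u = mulLetters v ↔ _
  simp only [tauOne_iff, Set.ext_iff, mem_mulLetters]

theorem prod_map_collapse {T : Type} [Monoid T] (φ : X → T) (l : List X)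
    (h : ∀ x, 2 ≤ l.count x → φ x * φ x = φ x) :
    ((collapse l).map φ).prod = (l.map φ).prod := by
  induction l with
  | nil => rfl
  | cons x l ih =>
    specialize ih fun y hy => h y (hy.trans List.count_le_count_cons)
    rw [List.map_cons, List.prod_cons, ← ih, collapse, pushLetter]
    split_ifs with hx
    · obtain ⟨l', hl'⟩ := eq_cons_of_head? hx
      have hxl : x ∈ l := mem_of_mem_collapse (hl' ▸ List.mem_cons_self)
      -- The letter heading the collapsed tail occurs in the tail itself, so it is repeated in the
      -- whole word and the hypothesis applies.
      have : φ x * φ x = φ x := h x (by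
        have := List.count_pos_iff.2 hxl
        rw [List.count_cons_self]; omega)
      rw [hl', List.map_cons, List.prod_cons, ← mul_assoc, this]
    · simp

theorem prod_map_eq_of_gammaCon {T : Type} [Monoid T] {u v : FreeMonoid X} (h : gammaCon X u v)
    (φ : X → T) (hφ : ∀ x, 2 ≤ u.toList.count x → φ x * φ x = φ x) :
    (u.toList.map φ).prod = (v.toList.map φ).prod := by
  obtain ⟨h₁, h₂⟩ := gammaCon_iff.1 h
  rw [← prod_map_collapse φ _ hφ, h₁, prod_map_collapse φ _ fun x hx => hφ x ((h₂ x).2 hx)]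

theorem collapse_map {Y : Type} [DecidableEq Y] {ι : X → Y} (hι : Function.Injective ι)
    (l : List X) : collapse (l.map ι) = (collapse l).map ι := by
  induction l with
  | nil => rfl
  | cons x l ih =>
    rw [List.map_cons, collapse, ih, collapse, pushLetter, pushLetter]
    cases h : collapse l with
    | nil => simp
    | cons y l' =>
      by_cases hxy : y = x
      · simp [hxy]
      · simp [hxy, hι.ne hxy]

theorem gammaCon_map {Y : Type} {ι : X → Y} (hι : Function.Injective ι)
    {u v : List X} (h : gammaCon X (FreeMonoid.ofList u) (FreeMonoid.ofList v)) :
    gammaCon Y (FreeMonoid.ofList (u.map ι)) (FreeMonoid.ofList (v.map ι)) := by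
  classical
  obtain ⟨h₁, h₂⟩ := gammaCon_iff.1 h
  simp only [FreeMonoid.toList_ofList] at h₁ h₂
  refine gammaCon_iff.2 ⟨by simp only [FreeMonoid.toList_ofList, collapse_map hι, h₁], fun y => ?_⟩
  simp only [FreeMonoid.toList_ofList]
  by_cases hy : ∃ x, ι x = y
  · obtain ⟨x, rfl⟩ := hy
    rw [List.count_map_of_injective _ _ hι, List.count_map_of_injective _ _ hι]
    exact h₂ x
  · have h0 : ∀ w : List X, (w.map ι).count y = 0 := fun w => List.count_eq_zero.2 fun hw => by
      obtain ⟨x, -, hx⟩ := List.mem_map.1 hw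
      exact hy ⟨x, hx⟩
    rw [h0, h0]

end Collapse

/-- The `γ`-class of a word given as a list of letters. -/
def gammaClass {𝔄 : Type} (l : List 𝔄) : (gammaCon 𝔄).Quotient :=
  ((FreeMonoid.ofList l : FreeMonoid 𝔄) : (gammaCon 𝔄).Quotient)

theorem gammaClass_append {𝔄 : Type} (l l' : List 𝔄) :
    gammaClass (l ++ l') = gammaClass l * gammaClass l' := rfl

/-! ### Monoids generated by words over finitely many letters -/

/-- Combinatorial data exhibiting a monoid `T` with zero as a monoid generating `𝕄_γ(w)`, where
`w` is a word over a finite set `K` of letters. -/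
structure WordModel (T K : Type) [Monoid T] [DecidableEq K] where
  /-- the zero -/
  zero : T
  mul_zero : ∀ x, x * zero = zero
  zero_mul : ∀ x, zero * x = zero
  /-- a square-zero element -/
  nil : T
  nil_ne_zero : nil ≠ zero
  nil_sq : nil * nil = zero
  one_ne_zero : (1 : T) ≠ zero
  /-- the letters that may be repeated -/
  idem : K → Prop
  /-- the main evaluation -/
  eval : K → T
  eval_idem : ∀ k, idem k → eval k * eval k = eval k
  /-- the normal forms of words with nonzero main evaluation -/
  normal : List (List K)
  nil_mem : [] ∈ normal
  cons_mem : ∀ k, ∀ w ∈ normal, ((k :: w).map eval).prod ≠ zero →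
    k :: w ∈ normal ∨ (idem k ∧ w.head? = some k)
  /-- evaluations separating the normal forms -/
  sep : List (K → T)
  sep_idem : ∀ θ ∈ sep, ∀ k, idem k → θ k * θ k = θ k
  sep_inj : ∀ w ∈ normal, ∀ w' ∈ normal,
    (∀ θ ∈ sep, (w.map θ).prod = (w'.map θ).prod) → w = w'
  /-- the defining word -/
  word : List K
  word_ne : (word.map eval).prod ≠ zero
  word_idem : ∀ k, 2 ≤ word.count k → idem k
  /-- words representing the elements of `T` -/
  repr : T → List K
  repr_one : repr 1 = []
  eval_repr : ∀ x, ((repr x).map eval).prod = x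
  repr_idem : ∀ x k, 2 ≤ (repr x).count k → idem k
  /-- contexts completing the representing words to the defining word -/
  left : T → List K
  right : T → List K
  context : ∀ x, x ≠ zero →
    collapse word = collapse (left x ++ repr x ++ right x) ∧
      ∀ k, 2 ≤ word.count k ↔ 2 ≤ (left x ++ repr x ++ right x).count k
  repr_mul : ∀ x y, x * y ≠ zero →
    collapse (repr (x * y)) = collapse (repr x ++ repr y) ∧
      ∀ k, 2 ≤ (repr (x * y)).count k ↔ 2 ≤ (repr x ++ repr y).count k

namespace WordModel

variable {T K 𝔄 : Type} [Monoid T] [DecidableEq K] (D : WordModel T K) (ι : K → 𝔄)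

/-- Extension of an evaluation to the whole alphabet, by zero. -/
noncomputable def extend (θ : K → T) : 𝔄 → T := Function.extend ι θ fun _ => D.zero

variable {ι} in
theorem extend_apply (hι : Function.Injective ι) (θ : K → T) (k : K) :
    D.extend ι θ (ι k) = θ k := hι.extend_apply _ _ _

variable {ι} in
theorem prod_extend (hι : Function.Injective ι) (θ : K → T) (w : List K) :
    ((w.map ι).map (D.extend ι θ)).prod = (w.map θ).prod := by
  rw [List.map_map]
  congr 1
  exact List.map_congr_left fun k _ => D.extend_apply hι θ k

/-- The congruence generated by `x = x²` for the letters that may be repeated. -/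
def con : Con (FreeMonoid 𝔄) :=
  conGen fun u v => ∃ k, D.idem k ∧ u = FreeMonoid.of (ι k) ∧
    v = FreeMonoid.of (ι k) * FreeMonoid.of (ι k)

theorem con_le_tauOne : D.con ι ≤ tauOne 𝔄 :=
  Con.conGen_mono <| by
    rintro _ _ ⟨k, -, rfl, rfl⟩
    exact ⟨ι k, rfl, rfl⟩

variable {ι} in
theorem prod_eq_of_con (hι : Function.Injective ι) {θ : K → T}
    (hθ : ∀ k, D.idem k → θ k * θ k = θ k) {u v : FreeMonoid 𝔄} (h : D.con ι u v) :
    (u.toList.map (D.extend ι θ)).prod = (v.toList.map (D.extend ι θ)).prod := by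
  have hle : D.con ι ≤ Con.ker (FreeMonoid.lift (D.extend ι θ)) := by
    refine Con.conGen_le.2 ?_
    rintro _ _ ⟨k, hk, rfl, rfl⟩
    rw [Con.ker_rel, map_mul, FreeMonoid.lift_eval_of, D.extend_apply hι, hθ k hk]
  have := hle h
  rwa [Con.ker_rel, FreeMonoid.lift_apply, FreeMonoid.lift_apply] at this

-- Reading the word from the right, every suffix still has nonzero value. Hence all letters come
-- from `K`, and each new letter either extends the normal form or is absorbed by an equal
-- idempotent head.
variable {ι} in
theorem exists_normal (hι : Function.Injective ι) (U : List 𝔄)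
    (hU : (U.map (D.extend ι D.eval)).prod ≠ D.zero) :
    ∃ w ∈ D.normal, D.con ι (FreeMonoid.ofList U) (FreeMonoid.ofList (w.map ι)) := by
  induction U with
  | nil => exact ⟨[], D.nil_mem, (D.con ι).refl _⟩
  | cons x U ih =>
    rw [List.map_cons, List.prod_cons] at hU
    obtain ⟨w, hw, hUw⟩ := ih fun h => hU (by rw [h, D.mul_zero])
    obtain ⟨k, rfl⟩ : ∃ k, ι k = x := by
      by_contra hx
      exact hU (by rw [extend, Function.extend_apply' _ _ _ hx, D.zero_mul])
    have hcons : D.con ι (FreeMonoid.ofList (ι k :: U)) (FreeMonoid.ofList ((k :: w).map ι)) :=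
      (D.con ι).mul ((D.con ι).refl (FreeMonoid.of (ι k))) hUw
    have hne : ((k :: w).map D.eval).prod ≠ D.zero := by
      rw [← D.prod_extend hι]
      have := D.prod_eq_of_con hι D.eval_idem hcons
      simp only [FreeMonoid.toList_ofList] at this
      rw [← this]
      simpa using hU
    rcases D.cons_mem k w hw hne with h | ⟨hk, hh⟩
    · exact ⟨_, h, hcons⟩
    · obtain ⟨w', rfl⟩ := eq_cons_of_head? hh
      refine ⟨_, hw, (D.con ι).trans hcons ?_⟩
      have hsq : D.con ι (FreeMonoid.of (ι k)) (FreeMonoid.of (ι k) * FreeMonoid.of (ι k)) :=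
        ConGen.Rel.of _ _ ⟨k, hk, rfl, rfl⟩
      exact (D.con ι).mul ((D.con ι).symm hsq) ((D.con ι).refl (FreeMonoid.ofList (w'.map ι)))

/-! ### Recovering multiplicities of letters from a square-zero element. -/

theorem nil_pow (n : ℕ) : D.nil ^ n = D.zero ↔ 2 ≤ n := by
  rcases n with _ | _ | n
  · simp [D.one_ne_zero]
  · simp [D.nil_ne_zero]
  · simp [pow_succ', ← mul_assoc, D.nil_sq, D.zero_mul]

theorem nil_pow_count (D : WordModel T K) {u v : List 𝔄} [DecidableEq 𝔄] (h : Satisfies T u v)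
    (x : 𝔄) : D.nil ^ u.count x = D.nil ^ v.count x := by
  have hp : ∀ w : List 𝔄, (w.map fun y => if y = x then D.nil else 1).prod = D.nil ^ w.count x := by
    intro w
    induction w with
    | nil => simp
    | cons y w ih =>
      by_cases hy : y = x
      · subst hy
        simp [ih, pow_succ']
      · simp [ih, hy, List.count_cons_of_ne hy]
  rw [← hp, ← hp, h]

theorem count_iff_of_satisfies (D : WordModel T K) {u v : List 𝔄} [DecidableEq 𝔄]
    (h : Satisfies T u v) (x : 𝔄) : 2 ≤ u.count x ↔ 2 ≤ v.count x := by
  rw [← D.nil_pow, ← D.nil_pow, D.nil_pow_count h]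

theorem mem_of_satisfies (D : WordModel T K) {u v : List 𝔄} (h : Satisfies T u v) {x : 𝔄}
    (hx : x ∈ u) : x ∈ v := by
  classical
  by_contra hv
  have h₁ := D.nil_pow_count h x
  rw [List.count_eq_zero.2 hv, pow_zero] at h₁
  -- Multiplying by one more `nil` treats the case where `x` occurs once in `u` together with the
  -- case of a repeated `x`.
  have h₂ : D.nil * D.nil ^ u.count x = D.zero := by
    rw [← pow_succ', D.nil_pow]
    have := List.count_pos_iff.2 hx
    omega
  rw [h₁, mul_one] at h₂
  exact D.nil_ne_zero h₂

theorem count_eq_one_of_satisfies (D : WordModel T K) {u v : List 𝔄} [DecidableEq 𝔄]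
    (h : Satisfies T u v) {x : 𝔄} (hx : u.count x = 1) : v.count x = 1 := by
  have h₁ := D.count_iff_of_satisfies h x
  have h₂ := List.count_pos_iff.2 (D.mem_of_satisfies h (List.count_pos_iff.1 (hx ▸ one_pos)))
  omega

-- Satisfaction transfers nonvanishing from `u` to `v`, so both have normal forms, and `sep` forces
-- these to agree. This gives `τ₁`; the condition on repeated letters comes separately from `nil`.
variable {ι} in
theorem gammaCon_of_satisfies (hι : Function.Injective ι) {u v : List 𝔄}
    (h : Satisfies T u v) (hu : (u.map (D.extend ι D.eval)).prod ≠ D.zero) :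
    gammaCon 𝔄 (FreeMonoid.ofList u) (FreeMonoid.ofList v) := by
  classical
  obtain ⟨w, hw, huw⟩ := D.exists_normal hι u hu
  obtain ⟨w', hw', hvw⟩ := D.exists_normal hι v (h _ ▸ hu)
  have : w = w' := D.sep_inj w hw w' hw' fun θ hθ => by
    have h₁ := D.prod_eq_of_con hι (D.sep_idem θ hθ) huw
    have h₂ := D.prod_eq_of_con hι (D.sep_idem θ hθ) hvw
    simp only [FreeMonoid.toList_ofList, D.prod_extend hι] at h₁ h₂
    rw [← h₁, ← h₂, h]
  subst this
  have ht := D.con_le_tauOne ι ((D.con ι).trans huw ((D.con ι).symm hvw))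
  exact gammaCon_iff.2 ⟨tauOne_iff.1 ht, fun x => D.count_iff_of_satisfies h x⟩

/-- The set consisting of the `γ`-class of the defining word. -/
def wordSet : Set (gammaCon 𝔄).Quotient := {gammaClass (D.word.map ι)}

-- The defining word is `γ`-related to a product `p * u * s`. The main evaluation is idempotent on
-- its repeated letters, so it respects this relation, and a zero factor would make the defining
-- word vanish.
variable {ι} in
theorem prod_ne_zero_of_mem (hι : Function.Injective ι) {u : FreeMonoid 𝔄}
    (hu : (u : (gammaCon 𝔄).Quotient) ∈ subwordClosure (gammaCon 𝔄) (D.wordSet ι)) :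
    (u.toList.map (D.extend ι D.eval)).prod ≠ D.zero := by
  classical
  obtain ⟨_, rfl, p, s, h⟩ := hu
  induction p, s using Con.induction_on₂ with
  | H p s =>
    have h' : gammaCon 𝔄 (FreeMonoid.ofList (D.word.map ι)) (p * u * s) := (Con.eq _).1 h
    have hw := prod_map_eq_of_gammaCon h' (D.extend ι D.eval) fun x hx => by
      rw [FreeMonoid.toList_ofList] at hx
      obtain ⟨k, -, rfl⟩ := List.mem_map.1 (List.count_pos_iff.1 (Nat.lt_of_lt_of_le Nat.zero_lt_two ‹_›))
      rw [List.count_map_of_injective _ _ hι] at hx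
      rw [D.extend_apply hι, D.eval_idem k (D.word_idem k hx)]
    intro h0
    rw [FreeMonoid.toList_ofList, D.prod_extend hι] at hw
    refine D.word_ne (hw.trans ?_)
    simp [h0, D.zero_mul, D.mul_zero]

variable {ι} in
theorem varMGamma_le (hι : Function.Injective ι) :
    varMGamma (D.wordSet ι) ≤ MonoidVariety.generatedBy T := by
  refine MonoidVariety.generatedBy_le_iff.2
    (MonoidVariety.mem_of_satisfies _ (MonoidVariety.mem_generatedBy T) fun u v huv => ?_)
  let π : FreeMonoid 𝔄 →* MTau (gammaCon 𝔄) (D.wordSet ι) :=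
    (Con.mk' _).comp (Con.mk' (gammaCon 𝔄))
  have hπ : Function.Surjective π := Con.mk'_surjective.comp Con.mk'_surjective
  choose r hr using hπ
  have hlift : ∀ w : List (MTau (gammaCon 𝔄) (D.wordSet ι)), π (w.map r).prod = w.prod := by
    intro w
    simp [map_list_prod, Function.comp_def, hr]
  -- Identities are closed under substitution, here of the chosen words for elements of `M_γ(w)`.
  have hsat : Satisfies T (u.map r).prod.toList (v.map r).prod.toList := fun φ => by
    have := huv fun x => FreeMonoid.lift φ (r x)
    simpa only [← FreeMonoid.lift_apply, map_list_prod, List.map_map, Function.comp_def] using this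
  rw [← hlift u, ← hlift v]
  refine (Con.eq _).2 ?_
  by_cases hu : (((u.map r).prod : FreeMonoid 𝔄) : (gammaCon 𝔄).Quotient) ∈
      subwordClosure (gammaCon 𝔄) (D.wordSet ι)
  · exact Or.inl ((Con.eq _).2 (D.gammaCon_of_satisfies hι hsat (D.prod_ne_zero_of_mem hι hu)))
  by_cases hv : (((v.map r).prod : FreeMonoid 𝔄) : (gammaCon 𝔄).Quotient) ∈
      subwordClosure (gammaCon 𝔄) (D.wordSet ι)
  · exact Or.inl ((Con.eq _).2
      (D.gammaCon_of_satisfies hι hsat.symm (D.prod_ne_zero_of_mem hι hv))).symm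
  · exact Or.inr ⟨hu, hv⟩

variable {ι} in
theorem gammaClass_map_eq (hι : Function.Injective ι) {u v : List K}
    (h : collapse u = collapse v ∧ ∀ k, 2 ≤ u.count k ↔ 2 ≤ v.count k) :
    gammaClass (u.map ι) = gammaClass (v.map ι) :=
  (Con.eq _).2 (gammaCon_map hι (gammaCon_iff.2 h))

variable {ι} in
theorem repr_mem_iff (hι : Function.Injective ι) (x : T) :
    gammaClass ((D.repr x).map ι) ∈ subwordClosure (gammaCon 𝔄) (D.wordSet ι) ↔ x ≠ D.zero := by
  constructor
  · intro h
    have := D.prod_ne_zero_of_mem hι h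
    rwa [FreeMonoid.toList_ofList, D.prod_extend hι, D.eval_repr] at this
  · intro h
    refine ⟨_, rfl, gammaClass ((D.left x).map ι), gammaClass ((D.right x).map ι), ?_⟩
    rw [← gammaClass_append, ← gammaClass_append, ← List.map_append, ← List.map_append]
    exact gammaClass_map_eq hι (D.context x h)

variable {ι} in
theorem generatedBy_le (hι : Function.Injective ι) :
    MonoidVariety.generatedBy T ≤ varMGamma (D.wordSet ι) := by
  classical
  -- The zero of `T` is also represented by a word; that word has value zero, so its class falls
  -- into the ideal.
  let f : T →* MTau (gammaCon 𝔄) (D.wordSet ι) :=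
    { toFun := fun x => (gammaClass ((D.repr x).map ι) : (gammaCon 𝔄).Quotient)
      map_one' := by rw [D.repr_one]; rfl
      map_mul' := fun x y => by
        rw [← Con.coe_mul, ← gammaClass_append, ← List.map_append]
        refine (Con.eq _).2 ?_
        by_cases h : x * y = D.zero
        · refine Or.inr ⟨fun h' => (D.repr_mem_iff hι _).1 h' h, fun h' => ?_⟩
          have := D.prod_ne_zero_of_mem hι h'
          rw [FreeMonoid.toList_ofList, D.prod_extend hι, List.map_append, List.prod_append,
            D.eval_repr, D.eval_repr] at this
          exact this h
        · exact Or.inl (gammaClass_map_eq hι (D.repr_mul x y h)) }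
  refine MonoidVariety.generatedBy_le_iff.2
    (MonoidVariety.mem_of_injective _ f (fun x y hxy => ?_) (MonoidVariety.mem_generatedBy _))
  rcases (Con.eq _).1 hxy with h | ⟨hx, hy⟩
  · have h' := prod_map_eq_of_gammaCon ((Con.eq _).1 h) (D.extend ι D.eval) fun z hz => by
      rw [FreeMonoid.toList_ofList] at hz
      obtain ⟨k, -, rfl⟩ := List.mem_map.1 (List.count_pos_iff.1 (Nat.lt_of_lt_of_le Nat.zero_lt_two ‹_›))
      rw [List.count_map_of_injective _ _ hι] at hz
      rw [D.extend_apply hι, D.eval_idem k (D.repr_idem x k hz)]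
    simpa only [FreeMonoid.toList_ofList, D.prod_extend hι, D.eval_repr] using h'
  · rw [Set.mem_compl_iff, D.repr_mem_iff hι, not_not] at hx hy
    rw [hx, hy]

variable {ι} in
theorem generatedBy_eq (hι : Function.Injective ι) :
    MonoidVariety.generatedBy T = varMGamma (D.wordSet ι) :=
  le_antisymm (D.generatedBy_le hι) (D.varMGamma_le hι)

end WordModel

/-! ### The word models of `A₀¹`, `Q¹`, `A¹` and the opposite of `A¹` -/

instance : Fintype SgA0 := ⟨{.e, .f, .fe, .zero}, by intro x; cases x <;> decide⟩

instance : Fintype SgQ := ⟨{.e, .b, .c, .bc, .zero}, by intro x; cases x <;> decide⟩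

instance : Fintype SgA := ⟨{.e, .f, .c, .fe, .fc, .zero}, by intro x; cases x <;> decide⟩

instance {S : Type} [Fintype S] : Fintype (WithOne S) := inferInstanceAs (Fintype (Option S))

instance {S : Type} [DecidableEq S] : DecidableEq (WithOne S) :=
  inferInstanceAs (DecidableEq (Option S))

instance {S : Type} [Fintype S] : Fintype Sᵐᵒᵖ := Fintype.ofEquiv S MulOpposite.opEquiv

/-- Words representing the elements of `A₀¹`. -/
def reprA0 : WithOne SgA0 → List (Fin 2)
  | none => []
  | some .f => [0, 0]
  | some .e => [1, 1]
  | some .fe => [0, 0, 1, 1]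
  | some .zero => [1, 1, 0, 0]

/-- The word model of `A₀¹`, with defining word `a²b²`. -/
def wordModelA0 : WordModel (WithOne SgA0) (Fin 2) where
  zero := (SgA0.zero : WithOne SgA0)
  mul_zero := by decide
  zero_mul := by decide
  nil := (SgA0.fe : WithOne SgA0)
  nil_ne_zero := by decide
  nil_sq := by decide
  one_ne_zero := by decide
  idem _ := True
  -- The first letter goes to `f`, because `fe` is nonzero while `ef = 0`.
  eval := ![(SgA0.f : WithOne SgA0), (SgA0.e : WithOne SgA0)]
  eval_idem := by decide
  normal := [[], [0], [1], [0, 1]]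
  nil_mem := by decide
  cons_mem := by decide
  sep := [![(SgA0.f : WithOne SgA0), (SgA0.e : WithOne SgA0)]]
  sep_idem := by decide
  sep_inj := by decide
  word := [0, 0, 1, 1]
  word_ne := by decide
  word_idem := by decide
  repr := reprA0
  repr_one := rfl
  eval_repr := by decide
  repr_idem := by decide
  left
    | some .e => [0, 0]
    | _ => []
  right
    | none => [0, 0, 1, 1]
    | some .f => [1, 1]
    | _ => []
  context := by decide
  repr_mul := by decide

/-- Words representing the elements of `Q¹`. -/
def reprQ : WithOne SgQ → List (Fin 3)
  | none => []
  | some .e => [0, 0]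
  | some .b => [0, 0, 1]
  | some .c => [2, 0, 0]
  | some .bc => [0, 0, 1, 2, 0, 0]
  | some .zero => [0, 0, 2, 0, 0]

set_option maxRecDepth 10000 in
/-- The word model of `Q¹`, with defining word `a²tsa²`. -/
def wordModelQ : WordModel (WithOne SgQ) (Fin 3) where
  zero := (SgQ.zero : WithOne SgQ)
  mul_zero := by decide
  zero_mul := by decide
  nil := (SgQ.b : WithOne SgQ)
  nil_ne_zero := by decide
  nil_sq := by decide
  one_ne_zero := by decide
  idem k := k = 0
  eval := ![(SgQ.e : WithOne SgQ), (SgQ.b : WithOne SgQ), (SgQ.c : WithOne SgQ)]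
  eval_idem := by decide
  normal := [[], [0], [1], [0, 1], [1, 2], [0, 1, 2], [1, 2, 0], [0, 1, 2, 0], [2], [2, 0]]
  nil_mem := by decide
  cons_mem := by decide
  -- Because `eb = b` and `ce = c`, the main evaluation cannot see `a` at either end. Erasing `t`
  -- exposes a leading `a` through `ec = 0`, and erasing `s` exposes a trailing one through `be =
  -- 0`.
  sep := [![(SgQ.e : WithOne SgQ), (SgQ.b : WithOne SgQ), (SgQ.c : WithOne SgQ)],
    ![(SgQ.e : WithOne SgQ), 1, (SgQ.c : WithOne SgQ)],
    ![(SgQ.e : WithOne SgQ), (SgQ.b : WithOne SgQ), 1]]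
  sep_idem := by decide
  sep_inj := by decide
  word := [0, 0, 1, 2, 0, 0]
  word_ne := by decide
  word_idem := by decide
  repr := reprQ
  repr_one := rfl
  eval_repr := by decide
  repr_idem := by decide
  left
    | some .c => [0, 0, 1]
    | _ => []
  right
    | none => [0, 0, 1, 2, 0, 0]
    | some .e => [1, 2, 0, 0]
    | some .b => [2, 0, 0]
    | _ => []
  context := by decide
  repr_mul := by decide

/-- Words representing the elements of `A¹`. -/
def reprA : WithOne SgA → List (Fin 3)
  | none => []
  | some .f => [0, 0]
  | some .e => [1, 1]
  | some .c => [1, 1, 2, 0, 0]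
  | some .fe => [0, 0, 1, 1]
  | some .fc => [0, 0, 1, 1, 2, 0, 0]
  | some .zero => [1, 1, 0, 0]

/-- Left contexts of the words representing the elements of `A¹`. -/
def leftA : WithOne SgA → List (Fin 3)
  | some .e => [0, 0]
  | some .c => [0, 0]
  | _ => []

/-- Right contexts of the words representing the elements of `A¹`. -/
def rightA : WithOne SgA → List (Fin 3)
  | none => [0, 0, 1, 1, 2, 0, 0]
  | some .f => [1, 1, 2, 0, 0]
  | some .e => [2, 0, 0]
  | some .fe => [2, 0, 0]
  | _ => []

/-- Evaluations separating the normal forms of `A¹`. -/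
def sepA : List (Fin 3 → WithOne SgA) :=
  -- The second and third evaluations detect an `a` before `t` (`ef = 0`) and after `t` (`ce = 0`);
  -- the last two detect whether `b` and `a` occur.
  [![(SgA.f : WithOne SgA), (SgA.e : WithOne SgA), (SgA.c : WithOne SgA)],
    ![(SgA.e : WithOne SgA), 1, (SgA.f : WithOne SgA)],
    ![(SgA.e : WithOne SgA), 1, (SgA.c : WithOne SgA)],
    ![1, (SgA.e : WithOne SgA), 1],
    ![(SgA.e : WithOne SgA), 1, 1]]

set_option maxRecDepth 10000 in
/-- The word model of `A¹`, with defining word `a²b²ta²`. -/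
def wordModelA : WordModel (WithOne SgA) (Fin 3) where
  zero := (SgA.zero : WithOne SgA)
  mul_zero := by decide
  zero_mul := by decide
  nil := (SgA.c : WithOne SgA)
  nil_ne_zero := by decide
  nil_sq := by decide
  one_ne_zero := by decide
  idem k := k ≠ 2
  eval := ![(SgA.f : WithOne SgA), (SgA.e : WithOne SgA), (SgA.c : WithOne SgA)]
  eval_idem := by decide
  normal := [[], [0], [1], [0, 1], [2], [0, 2], [1, 2], [0, 1, 2], [2, 0], [0, 2, 0], [1, 2, 0],
    [0, 1, 2, 0]]
  nil_mem := by decide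
  cons_mem := by decide
  sep := sepA
  sep_idem := by decide
  sep_inj := by decide
  word := [0, 0, 1, 1, 2, 0, 0]
  word_ne := by decide
  word_idem := by decide
  repr := reprA
  repr_one := rfl
  eval_repr := by decide
  repr_idem := by decide
  left := leftA
  right := rightA
  context := by decide
  repr_mul := by decide

set_option maxRecDepth 10000 in
/-- The word model of the opposite of `A¹`, with defining word `a²tb²a²`. -/
def wordModelAOp : WordModel (WithOne SgA)ᵐᵒᵖ (Fin 3) where
  zero := .op (SgA.zero : WithOne SgA)
  mul_zero := by decide
  zero_mul := by decide
  nil := .op (SgA.c : WithOne SgA)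
  nil_ne_zero := by decide
  nil_sq := by decide
  one_ne_zero := by decide
  idem k := k ≠ 2
  eval k := .op (![(SgA.f : WithOne SgA), (SgA.e : WithOne SgA), (SgA.c : WithOne SgA)] k)
  eval_idem := by decide
  normal := [[], [0], [1], [1, 0], [2], [2, 0], [2, 1], [2, 1, 0], [0, 2], [0, 2, 0], [0, 2, 1],
    [0, 2, 1, 0]]
  nil_mem := by decide
  cons_mem := by decide
  sep := sepA.map fun θ k => .op (θ k)
  sep_idem := by decide
  sep_inj := by decide
  word := [0, 0, 2, 1, 1, 0, 0]
  word_ne := by decide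
  word_idem := by decide
  repr x := (reprA x.unop).reverse
  repr_one := rfl
  eval_repr := by decide
  repr_idem := by decide
  left x := (rightA x.unop).reverse
  right x := (leftA x.unop).reverse
  context := by decide
  repr_mul := by decide

/-! ### Inclusions between the varieties -/

/-- The embedding of `A₀¹` into `A¹`. -/
def a0ToA : WithOne SgA0 →* WithOne SgA where
  toFun
    | none => 1
    | some .e => (SgA.e : WithOne SgA)
    | some .f => (SgA.f : WithOne SgA)
    | some .fe => (SgA.fe : WithOne SgA)
    | some .zero => (SgA.zero : WithOne SgA)
  map_one' := rfl
  map_mul' := by decide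

theorem a0ToA_injective : Function.Injective a0ToA :=
  fun x y => (by decide : ∀ x y, a0ToA x = a0ToA y → x = y) x y

/-- The anti-automorphism of `A₀¹` interchanging `e` and `f`. -/
def flipA0 : (WithOne SgA0)ᵐᵒᵖ →* WithOne SgA0 where
  toFun x := match x.unop with
    | some .e => (SgA0.f : WithOne SgA0)
    | some .f => (SgA0.e : WithOne SgA0)
    | y => y
  map_one' := rfl
  map_mul' := by decide

theorem flipA0_injective : Function.Injective flipA0 :=
  fun x y => (by decide : ∀ x y, flipA0 x = flipA0 y → x = y) x y

/-- The anti-automorphism of `Q¹` interchanging `b` and `c`. -/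
def flipQ : (WithOne SgQ)ᵐᵒᵖ →* WithOne SgQ where
  toFun x := match x.unop with
    | some .b => (SgQ.c : WithOne SgQ)
    | some .c => (SgQ.b : WithOne SgQ)
    | y => y
  map_one' := rfl
  map_mul' := by decide

theorem flipQ_injective : Function.Injective flipQ :=
  fun x y => (by decide : ∀ x y, flipQ x = flipQ y → x = y) x y

/-- The graph of a homomorphism from a submonoid of `A¹ × A¹` onto `Q¹`. -/
def graphQ : List ((WithOne SgA × WithOne SgA) × WithOne SgQ) :=
  [((1, 1), 1),
    (((SgA.f : WithOne SgA), 1), (SgQ.e : WithOne SgQ)),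
    (((SgA.fe : WithOne SgA), (SgA.f : WithOne SgA)), (SgQ.b : WithOne SgQ)),
    (((SgA.c : WithOne SgA), (SgA.e : WithOne SgA)), (SgQ.c : WithOne SgQ)),
    (((SgA.fc : WithOne SgA), (SgA.fe : WithOne SgA)), (SgQ.bc : WithOne SgQ)),
    (((SgA.fc : WithOne SgA), (SgA.e : WithOne SgA)), (SgQ.zero : WithOne SgQ))] ++
  [1, (SgA.e : WithOne SgA), (SgA.f : WithOne SgA), (SgA.c : WithOne SgA), (SgA.fe : WithOne SgA),
    (SgA.fc : WithOne SgA), (SgA.zero : WithOne SgA)].map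
      fun y => (((SgA.zero : WithOne SgA), y), (SgQ.zero : WithOne SgQ))

set_option maxRecDepth 10000 in
theorem graphQ_mul : ∀ g ∈ graphQ, ∀ h ∈ graphQ, g * h ∈ graphQ := by decide

/-- `graphQ` as a submonoid. -/
def graphQSubmonoid : Submonoid ((WithOne SgA × WithOne SgA) × WithOne SgQ) where
  carrier := {g | g ∈ graphQ}
  one_mem' := List.mem_cons_self
  mul_mem' := fun ha hb => graphQ_mul _ ha _ hb

-- `Q¹` is a quotient of a submonoid of `A¹ × A¹`, with `e`, `b`, `c` lifted to `(f, 1)`, `(fe, f)`,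
-- `(c, e)`. The second coordinate is needed to separate `bc`, lifted to `(fc, fe)`, from `ec = 0`,
-- lifted to `(fc, e)`.
set_option maxRecDepth 10000 in
theorem varA_mem_Q : varA.Mem (WithOne SgQ) := by
  have hA : varA.Mem (WithOne SgA) := MonoidVariety.mem_generatedBy _
  have hG : varA.Mem graphQSubmonoid :=
    MonoidVariety.mem_of_injective _ ((MonoidHom.fst _ _).comp graphQSubmonoid.subtype)
      (fun x y h => Subtype.ext ((by decide : ∀ x ∈ graphQ, ∀ y ∈ graphQ, x.1 = y.1 → x = y)
        x.1 x.2 y.1 y.2 h)) (MonoidVariety.mem_prod _ hA hA)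
  refine MonoidVariety.mem_of_surjective _ _ _
    ((MonoidHom.snd _ _).comp graphQSubmonoid.subtype) (fun q => ?_) hG
  obtain ⟨g, hg, hgq⟩ := (by decide : ∀ q, ∃ g ∈ graphQ, g.2 = q) q
  exact ⟨⟨g, hg⟩, hgq⟩

theorem varA_mem_A0 : varA.Mem (WithOne SgA0) :=
  MonoidVariety.mem_of_injective _ a0ToA a0ToA_injective (MonoidVariety.mem_generatedBy _)

theorem varA_dual_mem_A0 : varA.dual.Mem (WithOne SgA0) :=
  MonoidVariety.mem_of_injective varA flipA0 flipA0_injective varA_mem_A0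

theorem varA_dual_mem_Q : varA.dual.Mem (WithOne SgQ) :=
  MonoidVariety.mem_of_injective varA flipQ flipQ_injective varA_mem_Q

theorem varA_satisfies {N X : Type} [Monoid N] (hN : varA.Mem N) {u v : List X}
    (h : Satisfies (WithOne SgA) u v) : Satisfies N u v :=
  MonoidVariety.satisfies_of_mem hN h

theorem varA_dual_satisfies {N X : Type} [Monoid N] (hN : varA.dual.Mem N) {u v : List X}
    (h : Satisfies (WithOne SgA) u v) : Satisfies N u.reverse v.reverse :=
  Satisfies.reverse_of_op (MonoidVariety.satisfies_of_mem (N := Nᵐᵒᵖ) hN h)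

/-! ### Scattered subwords of length two -/

section Pairs

variable {X : Type} {x y : X}

theorem exists_eq_of_pair_sublist {l : List X} (h : [y, x].Sublist l) :
    ∃ l₁ l₂ l₃, l = l₁ ++ y :: (l₂ ++ x :: l₃) := by
  obtain ⟨r₁, r₂, rfl, h₁, h₂⟩ := List.cons_sublist_iff.1 h
  obtain ⟨s, t, rfl⟩ := List.append_of_mem h₁
  obtain ⟨s', t', rfl⟩ := List.append_of_mem (List.singleton_sublist.1 h₂)
  exact ⟨s, t ++ s', t', by simp⟩

theorem pair_sublist_of_append_left {p l : List X} (hy : y ∉ p)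
    (h : [y, x].Sublist (p ++ l)) : [y, x].Sublist l := by
  induction p with
  | nil => exact h
  | cons a p ih =>
    rw [List.mem_cons, not_or] at hy
    rw [List.cons_append, List.sublist_cons_iff] at h
    rcases h with h | ⟨r, hr, -⟩
    · exact ih hy.2 h
    · exact absurd (List.cons.inj hr).1 hy.1

theorem pair_sublist_of_append_right {l q : List X} (hx : x ∉ q)
    (h : [y, x].Sublist (l ++ q)) : [y, x].Sublist l := by
  have h' := List.reverse_sublist.2 h
  rw [List.reverse_append] at h'
  have := pair_sublist_of_append_left (by simpa using hx) h'
  exact List.reverse_sublist.1 this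

theorem pair_sublist_middle {p l q : List X} (hy : y ∉ p) (hx : x ∉ q) :
    [y, x].Sublist (p ++ l ++ q) ↔ [y, x].Sublist l :=
  ⟨fun h => pair_sublist_of_append_left hy (pair_sublist_of_append_right hx h), fun h =>
    (h.trans (List.sublist_append_right p l)).trans (List.sublist_append_left _ q)⟩

theorem pair_sublist_append {l l' : List X} (hy : y ∈ l) (hx : x ∈ l') :
    [y, x].Sublist (l ++ l') :=
  (List.singleton_sublist.2 hy).append (List.singleton_sublist.2 hx)

end Pairs

/-! ### Evaluation in `A¹` -/

/-- The elements `1`, `e` and `f` of `A¹`. -/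
def FlatA (g : WithOne SgA) : Prop := g = 1 ∨ g = (SgA.e : WithOne SgA) ∨ g = (SgA.f : WithOne SgA)

instance : DecidablePred FlatA := fun g => by unfold FlatA; infer_instance

/-- The products of elements `1`, `e` and `f` of `A¹`. -/
def FlatProdA (g : WithOne SgA) : Prop :=
  FlatA g ∨ g = (SgA.fe : WithOne SgA) ∨ g = (SgA.zero : WithOne SgA)

instance : DecidablePred FlatProdA := fun g => by unfold FlatProdA; infer_instance

theorem flatProdA_mul : ∀ g m, FlatA g → FlatProdA m → FlatProdA (g * m) := by decide

theorem zero_mul_A : ∀ g : WithOne SgA, (SgA.zero : WithOne SgA) * g = (SgA.zero : WithOne SgA) := by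
  decide

theorem mul_zero_A : ∀ g : WithOne SgA, g * (SgA.zero : WithOne SgA) = (SgA.zero : WithOne SgA) := by
  decide

/-- Consequently a repeated letter with a value other than `1`, `e`, `f` annihilates the word, so
only flat values of repeated letters need attention. -/
theorem mul_mul_of_not_flatA : ∀ g m : WithOne SgA, ¬ FlatA g →
    g * (m * g) = (SgA.zero : WithOne SgA) := by decide

/-- A finite check. The restriction on `w` is essential: for `m = 1`, `g = f`, `m' = e`, `w = c` the
two sides are `fc` and `0`. -/
theorem mul_flatA_insert : ∀ g, FlatA g → ∀ w, FlatProdA w → ∀ m m' : WithOne SgA,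
    m * g * m' * w * g = m * g * m' * g * w * g := by decide

section Evaluation

variable {X : Type} (φ : X → WithOne SgA)

theorem flatProdA_prod {l : List X} (hl : ∀ x ∈ l, FlatA (φ x)) : FlatProdA (l.map φ).prod := by
  induction l with
  | nil => exact Or.inl (Or.inl rfl)
  | cons x l ih =>
    rw [List.map_cons, List.prod_cons]
    exact flatProdA_mul _ _ (hl x List.mem_cons_self)
      (ih fun y hy => hl y (List.mem_cons_of_mem _ hy))

theorem prod_eq_zero_of_count [DecidableEq X] {l : List X} {y : X} (hy : 2 ≤ l.count y)
    (hφ : ¬ FlatA (φ y)) : (l.map φ).prod = (SgA.zero : WithOne SgA) := by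
  have h : [y, y].Sublist l := List.replicate_sublist_iff.2 hy
  obtain ⟨l₁, l₂, l₃, rfl⟩ := exists_eq_of_pair_sublist h
  have := mul_mul_of_not_flatA (φ y) (l₂.map φ).prod hφ
  simp only [List.map_append, List.prod_append, List.map_cons, List.prod_cons]
  rw [← mul_assoc (l₂.map φ).prod, ← mul_assoc (φ y), this, zero_mul_A, mul_zero_A]

/-- The only possible nonzero value of a word with a given content all of whose letters are
evaluated to `1`, `e` or `f`. -/
def contentValue (l : List X) : WithOne SgA :=
  (if ∃ x ∈ l, φ x = (SgA.f : WithOne SgA) then (SgA.f : WithOne SgA) else 1) *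
    (if ∃ x ∈ l, φ x = (SgA.e : WithOne SgA) then (SgA.e : WithOne SgA) else 1)

theorem contentValue_congr {l l' : List X} (h : ∀ x, x ∈ l ↔ x ∈ l') :
    contentValue φ l = contentValue φ l' := by
  simp only [contentValue, h]

/-- Since `ef = 0` and `fe ≠ 0`, a product of flat values survives only if no `e` precedes an `f`;
by idempotency it then depends only on which of the two values occur. -/
theorem prod_eq_contentValue_or {l : List X} (hl : ∀ x ∈ l, FlatA (φ x)) :
    (l.map φ).prod = contentValue φ l ∨ (l.map φ).prod = (SgA.zero : WithOne SgA) ∧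
      ∃ y x, [y, x].Sublist l ∧ φ y = (SgA.e : WithOne SgA) ∧ φ x = (SgA.f : WithOne SgA) := by
  classical
  induction l with
  | nil => left; simp [contentValue]
  | cons a l ih =>
    rw [List.map_cons, List.prod_cons]
    rcases ih fun y hy => hl y (List.mem_cons_of_mem _ hy) with h | ⟨h, y, x, hyx, hy, hx⟩
    · rw [h]
      rcases hl a List.mem_cons_self with ha | ha | ha
      · left
        simp [contentValue, ha]
      · by_cases hf : ∃ x ∈ l, φ x = (SgA.f : WithOne SgA)
        · right
          refine ⟨?_, ?_⟩
          · rw [contentValue, if_pos hf, ha]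
            split_ifs <;> decide
          · obtain ⟨x, hx, hxf⟩ := hf
            exact ⟨a, x, (List.singleton_sublist.2 hx).cons_cons a, ha, hxf⟩
        · left
          have hne : (SgA.e : WithOne SgA) ≠ (SgA.f : WithOne SgA) := by decide
          have hf' : ¬ ∃ x ∈ a :: l, φ x = (SgA.f : WithOne SgA) := by
            rintro ⟨x, hx, hxf⟩
            rcases List.mem_cons.1 hx with rfl | hx
            · exact hne (ha.symm.trans hxf)
            · exact hf ⟨x, hx, hxf⟩
          rw [contentValue, contentValue, if_neg hf, if_neg hf',
            if_pos (⟨a, List.mem_cons_self, ha⟩ : ∃ x ∈ a :: l, φ x = (SgA.e : WithOne SgA)), ha]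
          split_ifs <;> decide
      · left
        have hne : (SgA.f : WithOne SgA) ≠ (SgA.e : WithOne SgA) := by decide
        have he : (∃ x ∈ a :: l, φ x = (SgA.e : WithOne SgA)) ↔
            ∃ x ∈ l, φ x = (SgA.e : WithOne SgA) := by
          simp [ha, hne]
        simp only [contentValue, he]
        rw [if_pos (⟨a, List.mem_cons_self, ha⟩ : ∃ x ∈ a :: l, φ x = (SgA.f : WithOne SgA)), ha]
        split_ifs <;> decide
    · right
      exact ⟨by rw [h, mul_zero_A], y, x, hyx.cons a, hy, hx⟩

theorem contentValue_ne_zero (l : List X) : contentValue φ l ≠ (SgA.zero : WithOne SgA) := by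
  rw [contentValue]
  split_ifs <;> decide

theorem e_mul_mul_f : ∀ m, FlatProdA m → (SgA.e : WithOne SgA) * (m * (SgA.f : WithOne SgA)) =
    (SgA.zero : WithOne SgA) := by decide

theorem prod_eq_zero_iff {l : List X} (hl : ∀ x ∈ l, FlatA (φ x)) :
    (l.map φ).prod = (SgA.zero : WithOne SgA) ↔
      ∃ y x, [y, x].Sublist l ∧ φ y = (SgA.e : WithOne SgA) ∧ φ x = (SgA.f : WithOne SgA) := by
  refine ⟨fun h => ?_, ?_⟩
  · rcases prod_eq_contentValue_or φ hl with h' | h'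
    · exact absurd (h'.symm.trans h) (contentValue_ne_zero φ l)
    · exact h'.2
  · rintro ⟨y, x, hyx, hy, hx⟩
    obtain ⟨l₁, l₂, l₃, rfl⟩ := exists_eq_of_pair_sublist hyx
    have := e_mul_mul_f _ (flatProdA_prod φ (l := l₂) fun z hz => hl z (by simp [hz]))
    simp only [List.map_append, List.prod_append, List.map_cons, List.prod_cons, hy, hx]
    rw [← mul_assoc (l₂.map φ).prod, ← mul_assoc (SgA.e : WithOne SgA), this, zero_mul_A,
      mul_zero_A]

theorem prod_eq_of_zero_iff {l l' : List X} (hl : ∀ x ∈ l, FlatA (φ x))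
    (h : ∀ x, x ∈ l ↔ x ∈ l')
    (h0 : (l.map φ).prod = (SgA.zero : WithOne SgA) ↔ (l'.map φ).prod = (SgA.zero : WithOne SgA)) :
    (l.map φ).prod = (l'.map φ).prod := by
  rcases prod_eq_contentValue_or φ hl with h₁ | h₁
  · rcases prod_eq_contentValue_or φ (l := l') fun x hx => hl x ((h x).2 hx) with h₂ | h₂
    · rw [h₁, h₂, contentValue_congr φ h]
    · rw [h0.2 h₂.1, h₂.1]
  · rw [h₁.1, h0.1 h₁.1]

end Evaluation

/-- Send `y` to `e`, `x` to `f` and every other letter to `1`: the value is zero exactly when some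
`y` precedes some `x`. The computation is carried out in `A¹`, where the vanishing criterion is
available. -/
theorem pair_sublist_of_satisfies {X : Type} {u v : List X} (h : Satisfies (WithOne SgA0) u v)
    {x y : X} (hxy : x ≠ y) (hu : [y, x].Sublist u) : [y, x].Sublist v := by
  classical
  let ψ : X → WithOne SgA0 := fun z => if z = y then (SgA0.e : WithOne SgA0) else
    if z = x then (SgA0.f : WithOne SgA0) else 1
  have hψ : (u.map fun z => a0ToA (ψ z)).prod = (v.map fun z => a0ToA (ψ z)).prod := by
    simpa [map_list_prod, Function.comp_def] using congrArg a0ToA (h ψ)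
  have hflat : ∀ z, FlatA (a0ToA (ψ z)) := by
    intro z
    by_cases h₁ : z = y
    · exact Or.inr (Or.inl (by simp only [ψ, if_pos h₁]; rfl))
    · by_cases h₂ : z = x
      · exact Or.inr (Or.inr (by simp only [ψ, if_neg h₁, if_pos h₂]; rfl))
      · exact Or.inl (by simp only [ψ, if_neg h₁, if_neg h₂, map_one])
  have h0 := (prod_eq_zero_iff _ (l := u) fun z _ => hflat z).2
    ⟨y, x, hu, by simp only [ψ, if_pos]; rfl, by simp only [ψ, if_neg hxy, if_pos]; rfl⟩
  obtain ⟨y', x', hv, hy', hx'⟩ := (prod_eq_zero_iff _ (l := v) fun z _ => hflat z).1 (hψ ▸ h0)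
  have hy : y' = y := by
    by_contra hne
    by_cases h₂ : y' = x
    · simp only [ψ, if_neg hne, if_pos h₂] at hy'
      exact absurd hy' (by decide)
    · simp only [ψ, if_neg hne, if_neg h₂] at hy'
      exact absurd hy' (by decide)
  have hx : x' = x := by
    by_contra hne
    by_cases h₂ : x' = y
    · simp only [ψ, if_pos h₂] at hx'
      exact absurd hx' (by decide)
    · simp only [ψ, if_neg hne, if_neg h₂] at hx'
      exact absurd hx' (by decide)
  rwa [hy, hx] at hv

/-! ### Consequences of the identities of `A¹` -/

section Identities

variable {X : Type} [DecidableEq X]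

/-- The letter `x` and all letters of `w` are repeated. If one of them has a non-flat value, both
sides vanish; otherwise `mul_flatA_insert` applies. -/
theorem satisfies_insert (p w z : List X) (x : X) (hx : x ∈ p)
    (hw : ∀ y ∈ w, 2 ≤ (p ++ (w ++ x :: z)).count y) :
    Satisfies (WithOne SgA) (p ++ (w ++ x :: z)) (p ++ x :: (w ++ x :: z)) := by
  intro φ
  have hsub : (p ++ (w ++ x :: z)).Sublist (p ++ x :: (w ++ x :: z)) :=
    (List.Sublist.refl p).append (List.sublist_cons_self _ _)
  have hcx : 2 ≤ (p ++ (w ++ x :: z)).count x := by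
    have := List.count_pos_iff.2 hx
    simp only [List.count_append, List.count_cons_self]
    omega
  by_cases h : ∃ y, (y = x ∨ y ∈ w) ∧ ¬ FlatA (φ y)
  · obtain ⟨y, hy, hφ⟩ := h
    have hc : 2 ≤ (p ++ (w ++ x :: z)).count y := by
      rcases hy with rfl | hy
      exacts [hcx, hw y hy]
    rw [prod_eq_zero_of_count φ hc hφ, prod_eq_zero_of_count φ (hc.trans (hsub.count_le y)) hφ]
  · push Not at h
    obtain ⟨s, t, rfl⟩ := List.append_of_mem hx
    have := mul_flatA_insert (φ x) (h x (Or.inl rfl)) (w.map φ).prod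
      (flatProdA_prod φ fun y hy => h y (Or.inr hy)) (s.map φ).prod (t.map φ).prod
    simp only [List.map_append, List.prod_append, List.map_cons, List.prod_cons, ← mul_assoc]
    rw [this]

theorem satisfies_insert_left (p l B q : List X) (hp : ∀ x ∈ l, x ∈ p) (hB : ∀ x ∈ l, x ∈ B)
    (hc : ∀ x ∈ B, 2 ≤ (p ++ B ++ q).count x) :
    Satisfies (WithOne SgA) (p ++ B ++ q) (p ++ (l ++ B) ++ q) := by
  induction l with
  | nil => exact fun _ => rfl
  | cons x l ih =>
    refine (ih (fun y hy => hp y (List.mem_cons_of_mem _ hy))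
      fun y hy => hB y (List.mem_cons_of_mem _ hy)).trans ?_
    -- The copy of `x` already in the block serves as the later occurrence; everything in front of
    -- it consists of letters of `B`, hence of repeated letters.
    obtain ⟨w, z, hwz⟩ := List.append_of_mem (List.mem_append_right l (hB x List.mem_cons_self))
    have hsub : (p ++ B ++ q).Sublist (p ++ (l ++ B) ++ q) :=
      ((List.Sublist.refl p).append (List.sublist_append_right l B)).append (List.Sublist.refl q)
    have := satisfies_insert p w (z ++ q) x (hp x List.mem_cons_self) fun y hy => by
      have hyB : y ∈ B := by
        have : y ∈ l ++ B := hwz ▸ List.mem_append_left _ hy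
        rcases List.mem_append.1 this with h | h
        exacts [hB y (List.mem_cons_of_mem _ h), h]
      have h := (hc y hyB).trans (hsub.count_le y)
      rw [hwz] at h
      simpa using h
    simpa [hwz] using this

theorem satisfies_insert_right {N : Type} [Monoid N] (hN : varA.dual.Mem N) (p l B q : List X)
    (hq : ∀ x ∈ l, x ∈ q) (hB : ∀ x ∈ l, x ∈ B) (hc : ∀ x ∈ B, 2 ≤ (p ++ B ++ q).count x) :
    Satisfies N (p ++ B ++ q) (p ++ (B ++ l) ++ q) := by
  have := varA_dual_satisfies hN (satisfies_insert_left q.reverse l.reverse B.reverse p.reverse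
    (by simpa using hq) (by simpa using hB) fun x hx => by
      have := hc x (by simpa using hx)
      rw [← List.reverse_append, ← List.reverse_append, List.count_reverse]
      simpa using this)
  simpa using this

/-- With flat values, the two padded blocks have the same content, so their values agree once they
vanish together, that is, once the same pairs `e` before `f` occur. A pair with `y ∈ l` or `x ∈ l'`
occurs on both sides, so only the remaining pairs need a hypothesis. -/
theorem satisfies_reorder (p l B B' l' q : List X) (hl : ∀ x ∈ l, x ∈ B) (hl' : ∀ x ∈ l', x ∈ B)
    (hB : ∀ x, x ∈ B ↔ x ∈ B') (hc : ∀ x ∈ B, 2 ≤ (p ++ B ++ q).count x)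
    (hc' : ∀ x ∈ B', 2 ≤ (p ++ B' ++ q).count x)
    (hord : ∀ x ∈ B, ∀ y ∈ B, x ≠ y → y ∉ l → x ∉ l' →
      ([y, x].Sublist B ↔ [y, x].Sublist B')) :
    Satisfies (WithOne SgA) (p ++ (l ++ B ++ l') ++ q) (p ++ (l ++ B' ++ l') ++ q) := by
  intro φ
  have hsub : ∀ C : List X, (p ++ C ++ q).Sublist (p ++ (l ++ C ++ l') ++ q) := fun C =>
    ((List.Sublist.refl p).append ((List.sublist_append_right l C).trans
      (List.sublist_append_left _ l'))).append (List.Sublist.refl q)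
  by_cases h : ∃ y ∈ B, ¬ FlatA (φ y)
  · obtain ⟨y, hy, hφ⟩ := h
    rw [prod_eq_zero_of_count φ ((hc y hy).trans ((hsub B).count_le y)) hφ,
      prod_eq_zero_of_count φ ((hc' y ((hB y).1 hy)).trans ((hsub B').count_le y)) hφ]
  push Not at h
  have hmem : ∀ x, x ∈ l ++ B ++ l' ↔ x ∈ B := fun x => by
    simp only [List.mem_append]
    exact ⟨by rintro ((h | h) | h); exacts [hl x h, h, hl' x h], fun h => Or.inl (Or.inr h)⟩
  have hmem' : ∀ x, x ∈ l ++ B' ++ l' ↔ x ∈ B := fun x => by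
    simp only [List.mem_append]
    exact ⟨by rintro ((h | h) | h); exacts [hl x h, (hB x).2 h, hl' x h],
      fun h => Or.inl (Or.inr ((hB x).1 h))⟩
  have hpair : ∀ C C' : List X, (∀ x ∈ B, x ∈ C') →
      (∀ x ∈ B, ∀ y ∈ B, x ≠ y → y ∉ l → x ∉ l' → [y, x].Sublist C → [y, x].Sublist C') →
      ∀ x ∈ B, ∀ y ∈ B, x ≠ y → [y, x].Sublist (l ++ C ++ l') →
        [y, x].Sublist (l ++ C' ++ l') := by
    intro C C' hC hCC x hx y hy hxy hs
    by_cases hyl : y ∈ l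
    · rw [List.append_assoc]
      exact pair_sublist_append hyl (List.mem_append_left _ (hC x hx))
    by_cases hxl : x ∈ l'
    · exact pair_sublist_append (List.mem_append_right _ (hC y hy)) hxl
    exact (pair_sublist_middle hyl hxl).2
      (hCC x hx y hy hxy hyl hxl ((pair_sublist_middle hyl hxl).1 hs))
  have hne : ∀ {x y}, φ y = (SgA.e : WithOne SgA) → φ x = (SgA.f : WithOne SgA) → x ≠ y := by
    rintro x _ hy hx rfl
    exact absurd (hx.symm.trans hy) (by decide)
  have hflat : ∀ x ∈ l ++ B ++ l', FlatA (φ x) := fun x hx => h x ((hmem x).1 hx)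
  have hflat' : ∀ x ∈ l ++ B' ++ l', FlatA (φ x) := fun x hx => h x ((hmem' x).1 hx)
  have key : ((l ++ B ++ l').map φ).prod = ((l ++ B' ++ l').map φ).prod := by
    refine prod_eq_of_zero_iff φ hflat (fun x => (hmem x).trans (hmem' x).symm) ?_
    rw [prod_eq_zero_iff φ hflat, prod_eq_zero_iff φ hflat']
    constructor
    · rintro ⟨y, x, hs, hy, hx⟩
      exact ⟨y, x, hpair B B' (fun x => (hB x).1)
        (fun x hx y hy hxy h₁ h₂ => (hord x hx y hy hxy h₁ h₂).1) x
        ((hmem x).1 (hs.subset (by simp))) y ((hmem y).1 (hs.subset (by simp))) (hne hy hx) hs,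
        hy, hx⟩
    · rintro ⟨y, x, hs, hy, hx⟩
      exact ⟨y, x, hpair B' B (fun x hx => hx)
        (fun x hx y hy hxy h₁ h₂ => (hord x hx y hy hxy h₁ h₂).2) x
        ((hmem' x).1 (hs.subset (by simp))) y ((hmem' y).1 (hs.subset (by simp))) (hne hy hx) hs,
        hy, hx⟩
  rw [List.map_append, List.map_append, List.prod_append, List.prod_append, key,
    ← List.prod_append, ← List.map_append, ← List.prod_append, ← List.map_append]

/-- A block of letters that are not simple may be replaced by another block with the same content
provided that the mutual order of last and first occurrences of letters is not changed. -/
theorem satisfies_replace_block {N : Type} [Monoid N] (hN : varA.Mem N) (hN' : varA.dual.Mem N)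
    (p B B' q : List X) (hB : ∀ x, x ∈ B ↔ x ∈ B')
    (hc : ∀ x ∈ B, 2 ≤ (p ++ B ++ q).count x) (hc' : ∀ x ∈ B', 2 ≤ (p ++ B' ++ q).count x)
    (hord : ∀ x ∈ B, ∀ y ∈ B, x ≠ y → y ∉ p → x ∉ q →
      ([y, x].Sublist B ↔ [y, x].Sublist B')) :
    Satisfies N (p ++ B ++ q) (p ++ B' ++ q) := by
  -- The padding is maximal: `l` holds every letter of the block that occurs to its left, and `l'`
  -- every one that occurs to its right. Identities of `𝔸` insert `l`, those of its dual insert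
  -- `l'`.
  let l := B.filter fun x => x ∈ p
  let l' := B.filter fun x => x ∈ q
  have hl : ∀ x ∈ l, x ∈ B ∧ x ∈ p := fun x hx => by simpa [l] using hx
  have hl' : ∀ x ∈ l', x ∈ B ∧ x ∈ q := fun x hx => by simpa [l'] using hx
  have hfill : ∀ C : List X, (∀ x ∈ B, x ∈ C) → (∀ x ∈ C, x ∈ B) →
      (∀ x ∈ C, 2 ≤ (p ++ C ++ q).count x) →
      Satisfies N (p ++ C ++ q) (p ++ (l ++ C ++ l') ++ q) := by
    intro C hC hC' hcC
    have hsub : (p ++ C ++ q).Sublist (p ++ (l ++ C) ++ q) :=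
      ((List.Sublist.refl p).append (List.sublist_append_right l C)).append (List.Sublist.refl q)
    refine (varA_satisfies hN (satisfies_insert_left p l C q (fun x hx => (hl x hx).2)
      (fun x hx => hC x (hl x hx).1) hcC)).trans ?_
    refine satisfies_insert_right hN' p l' (l ++ C) q (fun x hx => (hl' x hx).2)
      (fun x hx => List.mem_append_right _ (hC x (hl' x hx).1)) fun x hx => ?_
    have hxC : x ∈ C := by
      rcases List.mem_append.1 hx with h | h
      exacts [hC x (hl x h).1, h]
    exact (hcC x hxC).trans (hsub.count_le x)
  refine (hfill B (fun _ h => h) (fun _ h => h) hc).trans (Satisfies.trans ?_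
    (hfill B' (fun x => (hB x).1) (fun x => (hB x).2) hc').symm)
  refine varA_satisfies hN (satisfies_reorder p l B B' l' q (fun x hx => (hl x hx).1)
    (fun x hx => (hl' x hx).1) hB hc hc' fun x hx y hy hxy hyl hxl => hord x hx y hy hxy ?_ ?_)
  · exact fun hyp => hyl (by simp [l, hy, hyp])
  · exact fun hxq => hxl (by simp [l', hx, hxq])

end Identities

/-! ### Consequences of the identities of `Q¹` -/

section Blocks

variable {X : Type}

theorem prod_map_eq_e_or_one [DecidableEq X] (z : X) (φ : X → WithOne SgQ) (w : List X)
    (h : ∀ y ∈ w, φ y = if y = z then (SgQ.e : WithOne SgQ) else 1) :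
    (w.map φ).prod = if z ∈ w then (SgQ.e : WithOne SgQ) else 1 := by
  induction w with
  | nil => simp
  | cons y w ih =>
    rw [List.map_cons, List.prod_cons, h y List.mem_cons_self,
      ih fun x hx => h x (List.mem_cons_of_mem _ hx)]
    by_cases hy : y = z
    · subst hy
      by_cases hw : y ∈ w <;> simp only [hw, List.mem_cons, true_or, if_true, if_false] <;> decide
    · by_cases hw : z ∈ w <;> simp [hw, hy, Ne.symm hy]

theorem not_mem_of_count_eq_one [DecidableEq X] {l r : List X} {t : X}
    (h : (l ++ t :: r).count t = 1) : t ∉ l ∧ t ∉ r := by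
  simp only [List.count_append, List.count_cons_self] at h
  exact ⟨List.count_eq_zero.1 (by omega), List.count_eq_zero.1 (by omega)⟩

/-- Identities of `Q¹` preserve the content of a block between two simple letters, where either of
the two letters may be replaced by the corresponding end of the word. -/
theorem mem_block_of_satisfies [DecidableEq X] {p p' B B' q q' : List X}
    (hp : p = [] ∧ p' = [] ∨ ∃ s p₁ p₁', p = p₁ ++ [s] ∧ p' = p₁' ++ [s] ∧
      (p ++ B ++ q).count s = 1)
    (hq : q = [] ∧ q' = [] ∨ ∃ t q₁ q₁', q = t :: q₁ ∧ q' = t :: q₁' ∧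
      (p ++ B ++ q).count t = 1)
    (h : Satisfies (WithOne SgQ) (p ++ B ++ q) (p' ++ B' ++ q')) {z : X} (hz : z ∈ B) :
    z ∈ B' := by
  by_contra hz'
  rcases hp with ⟨rfl, rfl⟩ | ⟨s, p₁, p₁', rfl, rfl, hs⟩ <;>
  rcases hq with ⟨rfl, rfl⟩ | ⟨t, q₁, q₁', rfl, rfl, ht⟩
  · simp only [List.nil_append, List.append_nil] at h
    exact hz' (wordModelQ.mem_of_satisfies h hz)
  · have ht' := wordModelQ.count_eq_one_of_satisfies h ht
    obtain ⟨hB, hq₁⟩ := not_mem_of_count_eq_one ht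
    obtain ⟨hB', hq₁'⟩ := not_mem_of_count_eq_one ht'
    rw [List.nil_append] at hB hB'
    have htz : t ≠ z := fun h => hB (h ▸ hz)
    -- An occurrence of `z` before `t` gives `ec = 0`, whereas later occurrences are harmless since
    -- `ce = c`.
    let φ : X → WithOne SgQ := fun y =>
      if y = z then (SgQ.e : WithOne SgQ) else if y = t then (SgQ.c : WithOne SgQ) else 1
    have hw : ∀ w : List X, t ∉ w →
        (w.map φ).prod = if z ∈ w then (SgQ.e : WithOne SgQ) else 1 := fun w hw =>
      prod_map_eq_e_or_one z φ w fun y hy => by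
        have : y ≠ t := fun h => hw (h ▸ hy)
        simp [φ, this]
    have ht : φ t = (SgQ.c : WithOne SgQ) := by simp [φ, htz]
    have := h φ
    simp only [List.nil_append, List.map_append, List.prod_append, List.map_cons, List.prod_cons,
      hw _ hB, hw _ hB', hw _ hq₁, hw _ hq₁', ht, if_pos hz, if_neg hz'] at this
    revert this
    split_ifs <;> decide
  · have hs' := wordModelQ.count_eq_one_of_satisfies h hs
    simp only [List.append_nil, List.append_assoc, List.cons_append, List.nil_append] at hs hs'
    obtain ⟨hp₁, hB⟩ := not_mem_of_count_eq_one hs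
    obtain ⟨hp₁', hB'⟩ := not_mem_of_count_eq_one hs'
    have hsz : s ≠ z := fun h => hB (h ▸ hz)
    let φ : X → WithOne SgQ := fun y =>
      if y = z then (SgQ.e : WithOne SgQ) else if y = s then (SgQ.b : WithOne SgQ) else 1
    have hw : ∀ w : List X, s ∉ w →
        (w.map φ).prod = if z ∈ w then (SgQ.e : WithOne SgQ) else 1 := fun w hw =>
      prod_map_eq_e_or_one z φ w fun y hy => by
        have : y ≠ s := fun h => hw (h ▸ hy)
        simp [φ, this]
    have hs : φ s = (SgQ.b : WithOne SgQ) := by simp [φ, hsz]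
    have := h φ
    simp only [List.append_nil, List.map_append, List.prod_append, List.map_cons, List.prod_cons,
      List.map_nil, List.prod_nil, mul_one, hw _ hB, hw _ hB', hw _ hp₁, hw _ hp₁', hs, if_pos hz,
      if_neg hz'] at this
    revert this
    split_ifs <;> decide
  · have hs' := wordModelQ.count_eq_one_of_satisfies h hs
    have ht' := wordModelQ.count_eq_one_of_satisfies h ht
    obtain ⟨hpB, hq₁⟩ := not_mem_of_count_eq_one ht
    obtain ⟨hpB', hq₁'⟩ := not_mem_of_count_eq_one ht'
    simp only [List.append_assoc, List.cons_append, List.nil_append] at hs hs'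
    obtain ⟨hp₁, hBq⟩ := not_mem_of_count_eq_one hs
    obtain ⟨hp₁', hBq'⟩ := not_mem_of_count_eq_one hs'
    simp only [List.mem_append, List.mem_cons, List.not_mem_nil, or_false, not_or] at hpB hpB' hBq hBq'
    have htz : t ≠ z := fun h => hpB.2 (h ▸ hz)
    have hsz : s ≠ z := fun h => hBq.1 (h ▸ hz)
    -- Occurrences of `z` outside the block are absorbed by `eb = b` and `ce = c`; inside it `be =
    -- 0`, so the value is `bc` or zero according to whether the block avoids `z`.
    let φ : X → WithOne SgQ := fun y =>
      if y = z then (SgQ.e : WithOne SgQ) else if y = s then (SgQ.b : WithOne SgQ) else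
        if y = t then (SgQ.c : WithOne SgQ) else 1
    have hw : ∀ w : List X, s ∉ w → t ∉ w →
        (w.map φ).prod = if z ∈ w then (SgQ.e : WithOne SgQ) else 1 := fun w hs ht =>
      prod_map_eq_e_or_one z φ w fun y hy => by
        have h₁ : y ≠ s := fun h => hs (h ▸ hy)
        have h₂ : y ≠ t := fun h => ht (h ▸ hy)
        simp [φ, h₁, h₂]
    have hs : φ s = (SgQ.b : WithOne SgQ) := by simp [φ, hsz]
    have ht : φ t = (SgQ.c : WithOne SgQ) := by simp [φ, htz, hpB.1.2]
    have := h φ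
    simp only [List.map_append, List.prod_append, List.map_cons, List.prod_cons,
      List.map_nil, List.prod_nil, mul_one, hw _ hBq.1 hpB.2, hw _ hBq'.1 hpB'.2,
      hw _ hp₁ hpB.1.1, hw _ hp₁' hpB'.1.1, hw _ hBq.2.2 hq₁, hw _ hBq'.2.2 hq₁',
      hs, ht, if_pos hz, if_neg hz'] at this
    revert this
    split_ifs <;> decide

/-! ### The intersection of `𝔸` and its dual -/

theorem exists_first {P : X → Prop} {l : List X} (h : ∃ t ∈ l, P t) :
    ∃ B t r, l = B ++ t :: r ∧ P t ∧ ∀ y ∈ B, ¬ P y := by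
  induction l with
  | nil => simp at h
  | cons a l ih =>
    by_cases ha : P a
    · exact ⟨[], a, l, rfl, ha, by simp⟩
    · obtain ⟨B, t, r, rfl, ht, hB⟩ := ih (by simpa [ha] using h)
      exact ⟨a :: B, t, r, rfl, ht, by simpa [ha] using hB⟩

/-- Replacing one block of letters that are not simple in a consequence of the identities of
`A₀¹` and `Q¹`. -/
theorem satisfies_replace_of_satisfies {N : Type} [Monoid N] [DecidableEq X] (hN : varA.Mem N)
    (hN' : varA.dual.Mem N) {p B B' q q' : List X}
    (hp : p = [] ∨ ∃ s p₁, p = p₁ ++ [s] ∧ (p ++ B ++ q).count s = 1)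
    (hq : q = [] ∧ q' = [] ∨ ∃ t q₁ q₁', q = t :: q₁ ∧ q' = t :: q₁' ∧
      (p ++ B ++ q).count t = 1)
    (hc : ∀ x ∈ B, (p ++ B ++ q).count x ≠ 1)
    (h₀ : Satisfies (WithOne SgA0) (p ++ B ++ q) (p ++ B' ++ q'))
    (h : Satisfies (WithOne SgQ) (p ++ B ++ q) (p ++ B' ++ q')) :
    Satisfies N (p ++ B ++ q) (p ++ B' ++ q) := by
  have hq_swap : q' = [] ∧ q = [] ∨ ∃ t q₁ q₁', q' = t :: q₁ ∧ q = t :: q₁' ∧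
      (p ++ B' ++ q').count t = 1 :=
    hq.imp And.symm fun ⟨t, q₁, q₁', e, e', ht⟩ =>
      ⟨t, q₁', q₁, e', e, wordModelQ.count_eq_one_of_satisfies h ht⟩
  have hB : ∀ x, x ∈ B ↔ x ∈ B' := fun x =>
    ⟨mem_block_of_satisfies (hp.imp (fun e => ⟨e, e⟩) fun ⟨s, p₁, e, hs⟩ => ⟨s, p₁, p₁, e, e, hs⟩)
      hq h, mem_block_of_satisfies (hp.imp (fun e => ⟨e, e⟩) fun ⟨s, p₁, e, hs⟩ =>
        ⟨s, p₁, p₁, e, e, wordModelQ.count_eq_one_of_satisfies h hs⟩) hq_swap h.symm⟩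
  have hqq : ∀ x, x ∈ q ↔ x ∈ q' := by
    rcases hq with ⟨rfl, rfl⟩ | ⟨t, q₁, q₁', rfl, rfl, ht⟩
    · exact fun _ => Iff.rfl
    · have ht' := wordModelQ.count_eq_one_of_satisfies h ht
      -- Regrouping makes the whole tail after `t` a single block bounded by `t` and the end of the
      -- word.
      have e : ∀ (C r : List X), p ++ C ++ t :: r = (p ++ C ++ [t]) ++ r ++ [] := by simp
      rw [e B q₁] at ht
      rw [e B' q₁'] at ht'
      rw [e B q₁, e B' q₁'] at h
      have hiff : ∀ x, x ∈ q₁ ↔ x ∈ q₁' := fun x =>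
        ⟨mem_block_of_satisfies (Or.inr ⟨t, _, _, rfl, rfl, ht⟩) (Or.inl ⟨rfl, rfl⟩) h,
          mem_block_of_satisfies (Or.inr ⟨t, _, _, rfl, rfl, ht'⟩) (Or.inl ⟨rfl, rfl⟩) h.symm⟩
      simp [hiff]
  have hc₂ : ∀ x ∈ B, 2 ≤ (p ++ B ++ q).count x := fun x hx => by
    have h₁ := hc x hx
    have h₂ : 0 < (p ++ B ++ q).count x := List.count_pos_iff.2 (by simp [hx])
    omega
  have hc₂' : ∀ x ∈ B', 2 ≤ (p ++ B' ++ q).count x := fun x hx => by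
    -- The bound is known with `q'` in place of `q`. As `x` already occurs in `B'`, a tail can only
    -- matter through containing `x`, and both tails have the same content.
    have h₁ := (wordModelQ.count_iff_of_satisfies h x).1 (hc₂ x ((hB x).2 hx))
    have h₂ : 0 < B'.count x := List.count_pos_iff.2 hx
    have h₃ : 0 < q.count x ↔ 0 < q'.count x := by
      rw [List.count_pos_iff, List.count_pos_iff, hqq]
    simp only [List.count_append] at h₁ ⊢
    omega
  refine satisfies_replace_block hN hN' p B B' q hB hc₂ hc₂' fun x hx y hy hxy hyp hxq => ?_
  -- For `y ∉ p` and `x ∉ q`, the order inside the block is the order in the whole word, which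
  -- identities of `A₀¹` preserve.
  rw [← pair_sublist_middle (l := B) hyp hxq,
    ← pair_sublist_middle (l := B') hyp (fun h => hxq ((hqq x).2 h))]
  exact ⟨pair_sublist_of_satisfies h₀ hxy, pair_sublist_of_satisfies h₀.symm hxy⟩

/-- Induction on the part `r` not yet processed: replace the block up to the first simple letter of
`r`, then absorb that block and letter into the common prefix. -/
theorem satisfies_append_of_satisfies {N : Type} [Monoid N] [DecidableEq X] (hN : varA.Mem N)
    (hN' : varA.dual.Mem N) (n : ℕ) (p r r' : List X) (hr : r.length = n)
    (hp : p = [] ∨ ∃ s p₁, p = p₁ ++ [s] ∧ (p ++ r).count s = 1)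
    (h₀ : Satisfies (WithOne SgA0) (p ++ r) (p ++ r'))
    (h : Satisfies (WithOne SgQ) (p ++ r) (p ++ r')) :
    Satisfies N (p ++ r) (p ++ r') := by
  induction n using Nat.strong_induction_on generalizing p r r' with
  | _ n ih =>
  by_cases hs : ∃ t ∈ r, (p ++ r).count t = 1
  · obtain ⟨B, t, q, rfl, ht, hB⟩ := exists_first hs
    have ht' := wordModelQ.count_eq_one_of_satisfies h ht
    simp only [← List.append_assoc] at ht hB hp h₀ h
    obtain ⟨hpB, htq⟩ := not_mem_of_count_eq_one ht
    have htr' : t ∈ r' := by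
      have : t ∈ p ++ r' := List.count_pos_iff.1 (ht' ▸ one_pos)
      exact (List.mem_append.1 this).resolve_left fun h => hpB (List.mem_append_left _ h)
    obtain ⟨B', q', rfl⟩ := List.append_of_mem htr'
    simp only [← List.append_assoc] at ht' h₀ h ⊢
    -- The replacement is stated for an arbitrary monoid because it is also applied to `A₀¹` and
    -- `Q¹`: both lie in the intersection, so the shortened identity still holds in them and the
    -- induction can continue.
    have hrep : ∀ {M : Type} [Monoid M], varA.Mem M → varA.dual.Mem M →
        Satisfies M (p ++ B ++ t :: q) (p ++ B' ++ t :: q) := fun hM hM' =>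
      satisfies_replace_of_satisfies hM hM' hp (Or.inr ⟨t, q, q', rfl, rfl, ht⟩) hB h₀ h
    have h₀' := (hrep varA_mem_A0 varA_dual_mem_A0).symm.trans h₀
    have hQ := hrep varA_mem_Q varA_dual_mem_Q
    have h' := hQ.symm.trans h
    have htq' := wordModelQ.count_eq_one_of_satisfies hQ ht
    have e : ∀ r : List X, p ++ B' ++ t :: r = (p ++ B' ++ [t]) ++ r := by simp
    refine (hrep hN hN').trans ?_
    rw [e q] at htq'
    rw [e q, e q'] at h₀' h' ⊢
    exact ih q.length (by simp [← hr]; omega) _ q q' rfl (Or.inr ⟨t, _, rfl, htq'⟩) h₀' h'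
  · push Not at hs
    have := satisfies_replace_of_satisfies (B := r) (B' := r') (q := []) (q' := []) hN hN'
      (by simpa using hp) (Or.inl ⟨rfl, rfl⟩) (by simpa using hs) (by simpa using h₀)
      (by simpa using h)
    simpa using this

end Blocks

theorem varA_inf_dual : varA ⊓ varA.dual = varA0 ⊔ varQ := by
  apply le_antisymm
  · intro N _ hN
    have hA0 : (varA0 ⊔ varQ).Mem (WithOne SgA0) :=
      le_sup_left (a := varA0) _ (MonoidVariety.mem_generatedBy _)
    have hQ : (varA0 ⊔ varQ).Mem (WithOne SgQ) :=
      le_sup_right (a := varA0) _ (MonoidVariety.mem_generatedBy _)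
    refine MonoidVariety.mem_of_satisfies _ (MonoidVariety.mem_prod _ hA0 hQ) fun u v huv => ?_
    classical
    have := satisfies_append_of_satisfies (inf_le_left (a := varA) N hN)
      (inf_le_right (a := varA) N hN) _ [] u v rfl (Or.inl rfl)
      (huv.of_surjective (MonoidHom.fst _ _) Prod.fst_surjective)
      (huv.of_surjective (MonoidHom.snd _ _) Prod.snd_surjective) id
    simpa using this
  · exact sup_le
      (le_inf (MonoidVariety.generatedBy_le_iff.2 varA_mem_A0)
        (MonoidVariety.generatedBy_le_iff.2 varA_dual_mem_A0))
      (le_inf (MonoidVariety.generatedBy_le_iff.2 varA_mem_Q)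
        (MonoidVariety.generatedBy_le_iff.2 varA_dual_mem_Q))

/-! ### Generators of the form `M_γ(W)` -/

section Generators

variable {𝔄 : Type} {a b t : 𝔄}

theorem injective_vec_two (hab : a ≠ b) : Function.Injective ![a, b] := by
  intro i j h
  fin_cases i <;> fin_cases j <;> simp_all

theorem injective_vec_three (hab : a ≠ b) (hat : a ≠ t) (hbt : b ≠ t) :
    Function.Injective ![a, b, t] := by
  intro i j h
  fin_cases i <;> fin_cases j <;> simp_all

theorem varA0_eq (hab : a ≠ b) :
    varA0 = varMGamma {gPlus a * gPlus b} := by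
  have h : wordModelA0.wordSet ![a, b] = {gPlus a * gPlus b} := by
    have hw : gammaClass [a, a, b, b] = gPlus a * gPlus b := rfl
    rw [← hw]
    rfl
  rw [← h]
  exact wordModelA0.generatedBy_eq (injective_vec_two hab)

theorem varQ_eq (hab : a ≠ b) (hat : a ≠ t) (hbt : b ≠ t) :
    varQ = varMGamma {gPlus a * gLetter b * gLetter t * gPlus a} := by
  have h : wordModelQ.wordSet ![a, b, t] = {gPlus a * gLetter b * gLetter t * gPlus a} := by
    have hw : gammaClass [a, a, b, t, a, a] = gPlus a * gLetter b * gLetter t * gPlus a := rfl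
    rw [← hw]
    rfl
  rw [← h]
  exact wordModelQ.generatedBy_eq (injective_vec_three hab hat hbt)

theorem varA_eq (hab : a ≠ b) (hat : a ≠ t) (hbt : b ≠ t) :
    varA = varMGamma {gPlus a * gPlus b * gLetter t * gPlus a} := by
  have h : wordModelA.wordSet ![a, b, t] = {gPlus a * gPlus b * gLetter t * gPlus a} := by
    have hw : gammaClass [a, a, b, b, t, a, a] = gPlus a * gPlus b * gLetter t * gPlus a := rfl
    rw [← hw]
    rfl
  rw [← h]
  exact wordModelA.generatedBy_eq (injective_vec_three hab hat hbt)

theorem varA_dual_eq (hab : a ≠ b) (hat : a ≠ t) (hbt : b ≠ t) :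
    varA.dual = varMGamma {gPlus a * gLetter t * gPlus b * gPlus a} := by
  have h : wordModelAOp.wordSet ![a, b, t] = {gPlus a * gLetter t * gPlus b * gPlus a} := by
    have hw : gammaClass [a, a, t, b, b, a, a] = gPlus a * gLetter t * gPlus b * gPlus a := rfl
    rw [← hw]
    rfl
  rw [← h]
  exact (MonoidVariety.dual_generatedBy _).trans (wordModelAOp.generatedBy_eq (injective_vec_three hab hat hbt))

end Generators

theorem theorem4p2 {𝔄 : Type} (a b t s : 𝔄)
    (hab : a ≠ b) (hat : a ≠ t) (has : a ≠ s) (hbt : b ≠ t) (hbs : b ≠ s) (hts : t ≠ s) :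
    -- (i)
    (varQ = varMGamma {gPlus a * gLetter t * gLetter s * gPlus a}) ∧
    -- (ii)
    (varA ⊓ varA.dual = varA0 ⊔ varQ ∧
      varA0 ⊔ varQ =
        varMGamma {gPlus a * gPlus b, gPlus a * gLetter t * gLetter s * gPlus a}) ∧
    -- (iii)
    (varA = varMGamma {gPlus a * gPlus b * gLetter t * gPlus a} ∧
      varA.dual = varMGamma {gPlus a * gLetter t * gPlus b * gPlus a}) ∧
    -- (iv)
    (varA ⊔ varA.dual =
      varMGamma {gPlus a * gPlus b * gLetter t * gPlus a,
        gPlus a * gLetter t * gPlus b * gPlus a}) := by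
  refine ⟨varQ_eq hat has hts, ⟨varA_inf_dual, ?_⟩, ⟨varA_eq hab hat hbt, varA_dual_eq hab hat hbt⟩,
    ?_⟩
  · rw [Set.insert_eq, varMGamma_union, ← varA0_eq hab, ← varQ_eq hat has hts]
  · rw [Set.insert_eq, varMGamma_union, ← varA_eq hab hat hbt, ← varA_dual_eq hab hat hbt]
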